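/- Let $(A,\mathfrak m)$ be a Noetherian local ring of dimension $d\ge 1$ with infinite residue field, and let $I$ be an $\mathfrak m$-primary ideal such that the local ring $A/I$ is equicharacteristic (i.e. $A/I$ and its residue field have the same characteristic). Then there are unique integers $e_0(I),\dots,e_d(I)$, the Hilbert coefficients of $I$, such that for all sufficiently large $n$ the length of $A/I^{n+1}$ is finite and $$\ell(A/I^{n+1})=\sum_{i=0}^{d}(-1)^i e_i(I)\binom{n+d-i}{d-i}.$$ Put $\xi_p(I):=\max\{e_0(I),|e_1(I)|,\dots,|e_p(I)|\}$ for $0\le p\le d$. Then, for all $1\le i\le d$, $$(-1)^{i-1}e_i(I)<\frac{7}{12}\,\bigl(\xi_{i-1}(I)+1\bigr)^{2^i}-e_0(I).$$ -/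

import Mathlib

open Filter

/-- A local ring is equicharacteristic if it has the same characteristic as its residue field. -/
def IsEquicharLocalRing (R : Type*) [CommRing R] : Prop :=
  ∃ _ : IsLocalRing R, ringChar R = ringChar (IsLocalRing.ResidueField R)

/-- `I` is an `𝔪`-primary ideal of the local ring `A`. -/
def IsMaximalPrimary {A : Type*} [CommRing A] [IsLocalRing A] (I : Ideal A) : Prop :=
  I.IsPrimary ∧ I.radical = IsLocalRing.maximalIdeal A

/-- `IsHilbertCoeffs I d e`: the integers `e 0, …, e d` are the coefficients of the
Hilbert-Samuel polynomial of `I`, that is, for all large `n`, the length of `A / I ^ (n + 1)` is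
finite and equal to `∑_{i=0}^d (-1)^i e_i binom(n + d - i, d - i)`. The sequence is
extended by zero beyond `d`. -/
def IsHilbertCoeffs {A : Type*} [CommRing A] (I : Ideal A) (d : ℕ) (e : ℕ → ℤ) : Prop :=
  (∀ᶠ n : ℕ in atTop, ∃ l : ℕ, Module.length A (A ⧸ I ^ (n + 1)) = (l : ℕ∞) ∧
    (l : ℤ) = ∑ i ∈ Finset.range (d + 1),
      (-1) ^ i * e i * ((n + (d - i)).choose (d - i) : ℤ)) ∧
  ∀ i, d < i → e i = 0

/-- The functions `n ↦ binom(n + k, k)` are linearly independent, even for large `n` only. -/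
theorem eq_zero_of_eventually_sum_choose (d : ℕ) : ∀ g : ℕ → ℤ,
    (∀ᶠ n : ℕ in atTop, ∑ k ∈ Finset.range (d + 1), g k * ((n + k).choose k : ℤ) = 0) →
    ∀ k, k ≤ d → g k = 0 := by
  induction d with
  | zero =>
    intro g h k hk
    obtain ⟨n, hn⟩ := h.exists
    obtain rfl : k = 0 := by omega
    simpa using hn
  | succ d ih =>
    intro g h
    have key : ∀ k, k ≤ d → g (k + 1) = 0 := by
      apply ih (fun k => g (k + 1))
      obtain ⟨N, hN⟩ := eventually_atTop.1 h
      refine eventually_atTop.2 ⟨N + 1, fun n hn => ?_⟩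
      obtain ⟨m, rfl⟩ : ∃ m, n = m + 1 := ⟨n - 1, by omega⟩
      have h1 := hN (m + 1) (by omega)
      have h0 := hN m (by omega)
      rw [Finset.sum_range_succ'] at h0 h1
      have e : ∀ k, g (k + 1) * ((m + 1 + k).choose k : ℤ) =
          g (k + 1) * ((m + 1 + (k + 1)).choose (k + 1) : ℤ) -
            g (k + 1) * ((m + (k + 1)).choose (k + 1) : ℤ) := by
        intro k
        have : m + 1 + (k + 1) = (m + (k + 1)) + 1 := by ring
        rw [this, Nat.choose_succ_succ, show m + 1 + k = m + (k + 1) by ring]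
        push_cast
        ring
      simp only [e, Finset.sum_sub_distrib]
      simp only [Nat.choose_zero_right] at h0 h1
      linarith
    intro k hk
    cases k with
    | succ k => exact key k (by omega)
    | zero =>
      obtain ⟨n, hn⟩ := h.exists
      rw [Finset.sum_range_succ', Finset.sum_eq_zero] at hn
      · simpa using hn
      · intro k hk
        rw [key k (by simpa [Nat.lt_succ_iff] using hk), zero_mul]

/-- The Hilbert coefficients are uniquely determined. -/
theorem IsHilbertCoeffs.unique {A : Type*} [CommRing A] {I : Ideal A} {d : ℕ} {e f : ℕ → ℤ}
    (he : IsHilbertCoeffs I d e) (hf : IsHilbertCoeffs I d f) : e = f := by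
  have key := eq_zero_of_eventually_sum_choose d
    (fun k => (-1) ^ (d - k) * (e (d - k) - f (d - k))) (by
      filter_upwards [he.1, hf.1] with n h1 h2
      obtain ⟨l, hl, h1⟩ := h1
      obtain ⟨l', hl', h2⟩ := h2
      obtain rfl : l = l' := by
        rw [hl] at hl'
        exact_mod_cast hl'
      have h3 := h1.symm.trans h2
      rw [← sub_eq_zero, ← Finset.sum_sub_distrib, ← Finset.sum_range_reflect] at h3
      rw [← h3]
      refine Finset.sum_congr rfl fun k hk => ?_
      have hk : k ≤ d := by simpa [Nat.lt_succ_iff] using hk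
      have h4 : d + 1 - 1 - k = d - k := by omega
      have h5 : d - (d - k) = k := by omega
      rw [h4, h5]
      ring)
  funext i
  by_cases hi : i ≤ d
  · have h := key (d - i) (by omega)
    have h5 : d - (d - i) = i := by omega
    simp only [h5] at h
    have : e i - f i = 0 := by
      rcases mul_eq_zero.1 h with h | h
      · exact absurd h (pow_ne_zero _ (by norm_num))
      · exact h
    linarith
  · rw [he.2 i (by omega), hf.2 i (by omega)]

open Classical in
/-- The Hilbert coefficient `e_i(I)` of an `𝔪`-primary ideal `I` of a `d`-dimensional Noetherian
local ring (zero by convention if the Hilbert-Samuel polynomial does not have the required form). -/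
noncomputable def hilbertCoeff {A : Type*} [CommRing A] (I : Ideal A) (d : ℕ) : ℕ → ℤ :=
  if h : ∃ e : ℕ → ℤ, IsHilbertCoeffs I d e then h.choose else 0

/-- `ξ_p(I) = max {e_0(I), |e_1(I)|, …, |e_p(I)|}`. -/
noncomputable def hilbertXi {A : Type*} [CommRing A] (I : Ideal A) (d : ℕ) : ℕ → ℤ
  | 0 => hilbertCoeff I d 0
  | p + 1 => max (hilbertXi I d p) |hilbertCoeff I d (p + 1)|

-- The plan is to show that `n ↦ ℓ(A/I^(n+1))` behaves like the Hilbert function of a graded module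
-- over a polynomial ring with the residue field `κ` as coefficients, that such a function is
-- eventually a sum of binomials given by a decreasing list, and that the coefficients of such a sum
-- satisfy the bound.
--
-- Refine the `I`-adic filtration by the ideals `I^i (𝔪^j + I)`. Since `𝔪` raises `j`, the graded
-- pieces are `κ`-vector spaces, and generators of `I` act on them as commuting operators raising
-- `i`. One extra variable, acting by inclusion, turns the sum of all pieces with `i ≤ n` into the
-- degree `n` part of a module generated in degree zero. Its dimension is `ℓ(A/I^(n+1))`
-- (`length_eq_finrank_refinedSystem`).
--
-- Green's hyperplane restriction theorem (`GradedSystem.exists_finrank_le`) then gives `h (n+1) ≤ h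
-- n + (h (n+1))_⟨n+1⟩`. A descent on ordinals (`lexHilbert.exists_eventually_eq`) deduces that `h n
-- = ∑ⱼ binom(n - j + cⱼ, n - j)` for large `n`, with `c₀ ≥ c₁ ≥ …`. Comparison with a parameter
-- ideal inside `I` forces `cⱼ ≤ d`.
--
-- Let `bᵢ` count the `j` with `cⱼ ≥ d - i`. Then `b₀ = e₀`, the `bᵢ` increase, and expanding the
-- binomials gives `b_{i+1} ≤ (-1)^(i+1) e_{i+1} + E`, where the error `E` depends only on `b₀, …,
-- bᵢ` (`lexCount_le`). By induction `bᵢ + 1 ≤ (ξᵢ + 1)^(2^i)`, which makes `E ≤ (1/2) (ξᵢ +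
-- 1)^(2^(i+1))` (`lexError_le`). Together with `e₀ = b₀ ≤ b_{i+1}` this is the assertion, even with
-- `1/2` in place of `7/12`.

universe u v

/-! ### Arithmetic of the Macaulay-Green function. -/

/-- The Macaulay-Green function `h ↦ h_{⟨n⟩}`: if `h = ∑ binom(kᵢ, i)` is the `n`-th binomial
expansion of `h`, then `h_{⟨n⟩} = ∑ binom(kᵢ - 1, i)`. -/
def macaulayLower : ℕ → ℕ → ℕ
  -- A convention: a greedy expansion leaves no remainder in degree zero. The identity keeps the
  -- carry rule and the Lipschitz bound valid uniformly in `n`.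
  | 0, h => h
  | n + 1, h =>
    if h = 0 then 0 else
      (Nat.findGreatest (fun a => (a + n + 1).choose (n + 1) ≤ h) h + n).choose (n + 1) +
        macaulayLower n (h -
          (Nat.findGreatest (fun a => (a + n + 1).choose (n + 1) ≤ h) h + n + 1).choose (n + 1))

namespace macaulayLower

@[simp] theorem zero_right (n : ℕ) : macaulayLower n 0 = 0 := by
  cases n <;> simp [macaulayLower]

theorem lt_choose (a n : ℕ) : a < (a + n + 1).choose (n + 1) := by
  induction a with
  | zero => simp
  | succ a ih =>
    have h1 : (a + 1 + n + 1).choose (n + 1) =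
        (a + n + 1).choose n + (a + n + 1).choose (n + 1) := by
      rw [show a + 1 + n + 1 = (a + n + 1) + 1 by ring, Nat.choose_succ_succ]
    have h2 : 0 < (a + n + 1).choose n := Nat.choose_pos (by omega)
    omega

theorem choose_add_two (a n : ℕ) : (a + 1 + n + 1).choose (n + 1) =
    (a + n + 1).choose n + (a + n + 1).choose (n + 1) := by
  rw [show a + 1 + n + 1 = (a + n + 1) + 1 by ring, Nat.choose_succ_succ]

/-- By Pascal's rule the bound on `r` says exactly that `a` is the greedy choice. -/
theorem eq_of_lt {n a r : ℕ} (hr : r < (a + n + 1).choose n) :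
    macaulayLower (n + 1) ((a + n + 1).choose (n + 1) + r) =
      (a + n).choose (n + 1) + macaulayLower n r := by
  have key : Nat.findGreatest (fun b => (b + n + 1).choose (n + 1) ≤
      (a + n + 1).choose (n + 1) + r) ((a + n + 1).choose (n + 1) + r) = a := by
    rw [Nat.findGreatest_eq_iff]
    refine ⟨by have := lt_choose a n; omega, fun _ => by omega, fun {b} hb _ hle => ?_⟩
    have h1 : (a + 1 + n + 1).choose (n + 1) ≤ (b + n + 1).choose (n + 1) :=
      Nat.choose_le_choose _ (by omega)
    rw [choose_add_two] at h1
    omega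
  have hne : (a + n + 1).choose (n + 1) + r ≠ 0 := by have := lt_choose a n; omega
  rw [macaulayLower, if_neg hne, key, Nat.add_sub_cancel_left]

theorem eq_choose (a n : ℕ) : macaulayLower n ((a + n + 1).choose n) = (a + n).choose n := by
  cases n with
  | zero => simp [macaulayLower]
  | succ n =>
    have := eq_of_lt (n := n) (a := a + 1) (r := 0) (Nat.choose_pos (by omega))
    rw [add_zero, zero_right, add_zero] at this
    rw [show a + (n + 1) + 1 = a + 1 + n + 1 by ring, this]
    congr 1
    ring

/-- At the boundary value of `r` the leading binomial carries from `a` to `a + 1`, and Pascal's rule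
shows that both readings agree. This allows induction across carries. -/
theorem eq_of_le {n a r : ℕ} (hr : r ≤ (a + n + 1).choose n) :
    macaulayLower (n + 1) ((a + n + 1).choose (n + 1) + r) =
      (a + n).choose (n + 1) + macaulayLower n r := by
  rcases hr.lt_or_eq with hr | rfl
  · exact eq_of_lt hr
  · rw [eq_choose, add_comm ((a + n + 1).choose (n + 1)), ← choose_add_two]
    have := eq_choose a (n + 1)
    rw [show a + (n + 1) + 1 = a + 1 + n + 1 by ring] at this
    rw [this, show a + (n + 1) = a + n + 1 by ring, Nat.choose_succ_succ, add_comm]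

theorem exists_eq (n h : ℕ) (hh : 0 < h) :
    ∃ a r, h = (a + n + 1).choose (n + 1) + r ∧ r < (a + n + 1).choose n := by
  have h1 : (0 + n + 1).choose (n + 1) ≤ h := by simpa [Nat.one_le_iff_ne_zero] using hh.ne'
  have h0 := Nat.findGreatest_spec (P := fun b => (b + n + 1).choose (n + 1) ≤ h)
    (Nat.zero_le h) h1
  set a := Nat.findGreatest (fun b => (b + n + 1).choose (n + 1) ≤ h) h with ha
  refine ⟨a, h - (a + n + 1).choose (n + 1), by omega, ?_⟩
  by_contra! hc
  have h2 : (a + 1 + n + 1).choose (n + 1) ≤ h := by rw [choose_add_two]; omega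
  have h3 := Nat.le_findGreatest (P := fun b => (b + n + 1).choose (n + 1) ≤ h)
    ((lt_choose (a + 1) n).le.trans h2) h2
  omega

theorem step (n : ℕ) : ∀ h, macaulayLower n h ≤ macaulayLower n (h + 1) ∧
    macaulayLower n (h + 1) ≤ macaulayLower n h + 1 := by
  induction n with
  | zero => intro h; simp [macaulayLower]
  | succ n ih =>
    intro h
    rcases Nat.eq_zero_or_pos h with rfl | hh
    · have := eq_of_lt (n := n) (a := 0) (r := 0) (Nat.choose_pos (by omega))
      simp at this
      simp [this]
    · obtain ⟨a, r, rfl, hr⟩ := exists_eq n h hh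
      rw [add_assoc (Nat.choose _ _), eq_of_le hr.le, eq_of_le (r := r + 1) hr]
      have := ih r
      omega

theorem mono (n : ℕ) : Monotone (macaulayLower n) :=
  monotone_nat_of_le_succ fun h => (step n h).1

theorem add_le (n h k : ℕ) : macaulayLower n (h + k) ≤ macaulayLower n h + k := by
  induction k with
  | zero => simp
  | succ k ih => have := (step n (h + k)).2; rw [← add_assoc]; omega

@[simp] theorem succ_one (n : ℕ) : macaulayLower (n + 1) 1 = 0 := by
  have := eq_of_lt (n := n) (a := 0) (r := 0) (Nat.choose_pos (by omega))
  simpa using this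

theorem lt_self (n h : ℕ) (hh : 0 < h) : macaulayLower (n + 1) h < h := by
  have := add_le (n + 1) 1 (h - 1)
  rw [succ_one, Nat.add_sub_cancel' hh] at this
  omega

theorem one_left (h : ℕ) : macaulayLower 1 h = h - 1 := by
  cases h with
  | zero => simp
  | succ h =>
    have := eq_of_lt (n := 0) (a := h) (r := 0) (by simp)
    simpa using this

theorem lt_of_lt (n : ℕ) : ∀ a h, h < (a + n + 1).choose n →
    macaulayLower n h < (a + n).choose n := by
  induction n with
  | zero => intro a h hh; simpa [macaulayLower] using hh
  | succ n ih =>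
    intro a h hh
    rcases Nat.eq_zero_or_pos h with rfl | h0
    · simpa using Nat.choose_pos (by omega)
    · obtain ⟨b, r, rfl, hr⟩ := exists_eq n h h0
      rw [eq_of_lt hr]
      have hba : b ≤ a := by
        by_contra! hba
        have : (a + (n + 1) + 1).choose (n + 1) ≤ (b + n + 1).choose (n + 1) :=
          Nat.choose_le_choose _ (by omega)
        omega
      have h1 := ih b r hr
      have h2 : (b + n + 1).choose (n + 1) = (b + n).choose n + (b + n).choose (n + 1) :=
        Nat.choose_succ_succ _ _
      have h3 : (b + n + 1).choose (n + 1) ≤ (a + (n + 1)).choose (n + 1) :=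
        Nat.choose_le_choose _ (by omega)
      omega

/-- The critical case of `le_of_le_add`, at the first `c` exceeding `h_⟨n+1⟩`. The induction peels
off the leading binomial of `h`. -/
theorem add_lt_of_eq (n : ℕ) : ∀ h, macaulayLower (n + 1) h + 1 ≤ h →
    macaulayLower (n + 1) (macaulayLower (n + 1) h + 1) +
      macaulayLower n (h - (macaulayLower (n + 1) h + 1)) < macaulayLower (n + 1) h + 1 := by
  induction n with
  | zero =>
    intro h hh
    have h0 : ∀ k, macaulayLower 0 k = k := fun k => by simp [macaulayLower]
    simp only [zero_add, one_left, h0] at hh ⊢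
    omega
  | succ n ih =>
    intro h hh
    obtain ⟨a, r, rfl, hr⟩ := exists_eq (n + 1) h (by omega)
    rw [eq_of_lt hr] at hh ⊢
    have hc := lt_of_lt (n + 1) a r hr
    cases a with
    | zero =>
      have h0 : macaulayLower (n + 1) r = 0 := by simpa using hc
      have h1 : (0 + (n + 1)).choose (n + 1 + 1) = 0 := Nat.choose_eq_zero_of_lt (by omega)
      have h2 : (0 + (n + 1) + 1).choose (n + 1 + 1) = 1 := by simp
      rw [h0, h1, h2]
      simp [h0]
    | succ b =>
      have e1 : b + 1 + (n + 1) = b + (n + 1) + 1 := by ring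
      rw [e1] at hh hr hc ⊢
      set R := macaulayLower (n + 1) r with hR
      have e2 : (b + (n + 1) + 1 + 1).choose (n + 1 + 1) =
          (b + (n + 1) + 1).choose (n + 1) + (b + (n + 1) + 1).choose (n + 1 + 1) :=
        Nat.choose_succ_succ _ _
      have e3 : (b + (n + 1) + 1 + 1).choose (n + 1) =
          (b + (n + 1) + 1).choose n + (b + (n + 1) + 1).choose (n + 1) :=
        Nat.choose_succ_succ _ _
      have e4 : (b + (n + 1) + 1).choose (n + 1 + 1) =
          (b + (n + 1)).choose (n + 1) + (b + (n + 1)).choose (n + 1 + 1) :=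
        Nat.choose_succ_succ _ _
      rw [add_assoc _ R 1, eq_of_le (r := R + 1) (by omega)]
      by_cases hcr : R + 1 ≤ r
      -- The difference is again a leading binomial plus `r - (R + 1)`; after cancellation by
      -- Pascal's rule only the inductive claim for `r` remains.
      · have e5 : (b + (n + 1) + 1 + 1).choose (n + 1 + 1) + r -
            ((b + (n + 1) + 1).choose (n + 1 + 1) + (R + 1)) =
            ((b + 1) + n + 1).choose (n + 1) + (r - (R + 1)) := by
          rw [e2, show b + 1 + n + 1 = b + (n + 1) + 1 by ring]; omega
        have hb : r - (R + 1) ≤ (b + 1 + n + 1).choose n := by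
          have := add_le (n + 1) r ((b + (n + 1) + 1 + 1).choose (n + 1) - r)
          rw [Nat.add_sub_cancel' hr.le] at this
          have h6 := eq_choose (b + 1) (n + 1)
          rw [e1] at h6
          rw [h6] at this
          rw [show b + 1 + n + 1 = b + (n + 1) + 1 by ring]
          omega
        rw [e5, eq_of_le hb, show b + 1 + n = b + (n + 1) by ring]
        have := ih r hcr
        rw [← hR] at this
        omega
      · have hr0 : r = 0 := by
          by_contra h0
          have := lt_self n r (by omega)
          omega
        have hR0 : R = 0 := by rw [hR, hr0, zero_right]
        have := lt_of_lt (n + 1) b ((b + (n + 1) + 1 + 1).choose (n + 1 + 1) + r -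
          ((b + (n + 1) + 1).choose (n + 1 + 1) + (R + 1))) (by
            have : 0 < (b + (n + 1) + 1).choose (n + 1) := Nat.choose_pos (by omega)
            omega)
        have h7 : macaulayLower (n + 1) (R + 1) = 0 := by rw [hR0]; exact succ_one n
        omega

/-- The numerical lemma behind Green's hyperplane restriction theorem. -/
theorem le_of_le_add {n h c : ℕ} (hch : c ≤ h)
    (hc : c ≤ macaulayLower (n + 1) c + macaulayLower n (h - c)) :
    c ≤ macaulayLower (n + 1) h := by
  by_contra! hlt
  have h1 := add_lt_of_eq n h (by omega)
  -- As `c` grows, `c_⟨n+1⟩ - c` and `(h - c)_⟨n⟩` do not increase, so the strict inequality at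
  -- `h_⟨n+1⟩ + 1` persists up to `c`.
  have h2 := add_le (n + 1) (macaulayLower (n + 1) h + 1) (c - (macaulayLower (n + 1) h + 1))
  rw [Nat.add_sub_cancel' hlt] at h2
  have h3 : macaulayLower n (h - c) ≤ macaulayLower n (h - (macaulayLower (n + 1) h + 1)) :=
    mono n (by omega)
  omega

end macaulayLower

/-! ### Lexicographic Hilbert functions and eventual equality. -/

/-- `lexHilbert [c₀, c₁, …] n = ∑ⱼ binom(n - j + cⱼ, n - j)`, the Hilbert function of a
lexicographic quotient of a polynomial ring. -/
def lexHilbert : List ℕ → ℕ → ℕ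
  | [], _ => 0
  | a :: l, n => (a + n).choose n + lexHilbert l (n - 1)

/-- The Hilbert function of the hyperplane section of the lexicographic quotient. -/
def lexHilbertLower : List ℕ → ℕ → ℕ
  | [], _ => 0
  | a :: l, n => (a + n - 1).choose n + lexHilbertLower l (n - 1)

namespace lexHilbert

/-- Used for tails: it bounds the remainder after the leading binomial, so a decreasing list is its
own Macaulay expansion. -/
theorem lt_choose : ∀ (l : List ℕ) (n a : ℕ), l.Pairwise (· ≥ ·) → (∀ b ∈ l, b ≤ a) →
    l.length ≤ n → lexHilbert l n < (a + n + 1).choose n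
  | [], n, a, _, _, _ => by simpa [lexHilbert] using Nat.choose_pos (by omega)
  | b :: l, 0, a, _, _, h => by simp at h
  | b :: l, n + 1, a, hp, ha, h => by
    rw [List.pairwise_cons] at hp
    have h1 := lt_choose l n b hp.2 hp.1 (by simpa using h)
    have h2 : (b + n + 1 + 1).choose (n + 1) =
      (b + n + 1).choose n + (b + n + 1).choose (n + 1) := Nat.choose_succ_succ _ _
    have h3 : (b + n + 1 + 1).choose (n + 1) ≤ (a + (n + 1) + 1).choose (n + 1) :=
      Nat.choose_le_choose _ (by have := ha b (by simp); omega)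
    simp only [lexHilbert, Nat.add_sub_cancel, ← add_assoc] at h3 ⊢
    omega

theorem macaulayLower_eq : ∀ (l : List ℕ) (n : ℕ), l.Pairwise (· ≥ ·) → l.length ≤ n →
    macaulayLower n (lexHilbert l n) = lexHilbertLower l n
  | [], n, _, _ => by simp [lexHilbert, lexHilbertLower]
  | b :: l, 0, _, h => by simp at h
  | b :: l, n + 1, hp, h => by
    rw [List.pairwise_cons] at hp
    have h1 := lt_choose l n b hp.2 hp.1 (by simpa using h)
    have h2 := macaulayLower_eq l n hp.2 (by simpa using h)
    simp only [lexHilbert, lexHilbertLower, Nat.add_sub_cancel, ← add_assoc]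
    rw [macaulayLower.eq_of_lt h1, h2]

theorem succ_eq : ∀ (l : List ℕ) (n : ℕ), l.length ≤ n + 1 →
    lexHilbert l (n + 1) = lexHilbertLower l (n + 1) + lexHilbert l n
  | [], n, _ => by simp [lexHilbert, lexHilbertLower]
  | [b], n, h => by
    simp only [lexHilbert, lexHilbertLower, ← add_assoc, Nat.add_sub_cancel]
    rw [Nat.choose_succ_succ']
    omega
  | b :: c :: l, 0, h => by simp at h
  | b :: c :: l, n + 1, h => by
    have h1 := succ_eq (c :: l) n (by simpa using h)
    rw [lexHilbert, lexHilbertLower, lexHilbert.eq_def (b :: c :: l) (n + 1)]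
    simp only [Nat.add_sub_cancel]
    rw [h1, ← add_assoc b (n + 1) 1, Nat.add_sub_cancel, Nat.choose_succ_succ']
    omega

theorem append : ∀ (l m : List ℕ) (n : ℕ),
    lexHilbert (l ++ m) n = lexHilbert l n + lexHilbert m (n - l.length)
  | [], m, n => by simp [lexHilbert]
  | a :: l, m, n => by
    simp only [List.cons_append, lexHilbert, List.length_cons, append l m]
    rw [Nat.sub_sub, add_comm 1 l.length, add_assoc]

theorem lower_append_zero : ∀ (l : List ℕ) (n : ℕ), l.length ≤ n →
    lexHilbertLower (l ++ [0]) (n + 1) = lexHilbertLower l (n + 1)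
  | [], n, _ => by simp [lexHilbertLower]
  | a :: l, 0, h => by simp at h
  | a :: l, n + 1, h => by
    have := lower_append_zero l n (by simpa using h)
    simp only [List.cons_append, lexHilbertLower, Nat.add_sub_cancel]
    rw [this]

theorem replicate (b : ℕ) : ∀ k, lexHilbert (List.replicate k b) k + 1 = (b + 1 + k).choose k
  | 0 => by simp [lexHilbert]
  | k + 1 => by
    have := replicate b k
    rw [List.replicate_succ, lexHilbert, Nat.add_sub_cancel, add_assoc, this]
    rw [show b + 1 + (k + 1) = (b + 1 + k) + 1 by ring, Nat.choose_succ_succ,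
      show b + (k + 1) = b + 1 + k by ring, add_comm]

/-- Macaulay's growth theorem in numerical form. -/
theorem le_succ {l : List ℕ} {n a b : ℕ} (hl : l.Pairwise (· ≥ ·)) (hn : l.length ≤ n)
    (ha : a ≤ lexHilbert l n) (hab : b ≤ a + macaulayLower (n + 1) b) :
    b ≤ lexHilbert l (n + 1) := by
  by_contra! hlt
  -- Appending a zero adds one to the value without changing the hyperplane section, so exceeding
  -- `lexHilbert l (n + 1)` contradicts the 1-Lipschitz bound.
  have h1 : lexHilbert (l ++ [0]) (n + 1) = lexHilbert l (n + 1) + 1 := by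
    rw [append]; simp [lexHilbert]
  have h2 := macaulayLower_eq (l ++ [0]) (n + 1)
    (List.pairwise_append.2 ⟨hl, by simp, by simp⟩) (by simpa using hn)
  rw [h1, lower_append_zero l n hn] at h2
  have h3 := macaulayLower.add_le (n + 1) (lexHilbert l (n + 1) + 1)
    (b - (lexHilbert l (n + 1) + 1))
  rw [Nat.add_sub_cancel' hlt] at h3
  have h4 := succ_eq l n (by omega)
  omega

/-- An upper bound by a list persists in all later degrees. If it is ever strict, a final `0` can be
dropped, or a final `b + 1` replaced by finitely many copies of `b`, at a cost of one in that
degree. Either move lowers the ordinal `∑ ω^cⱼ`, so the descent stops, with equality from some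
degree on. -/
theorem exists_eventually_eq_aux {h : ℕ → ℕ}
    (hh : ∀ n, h (n + 1) ≤ h n + macaulayLower (n + 1) (h (n + 1))) (o : Ordinal.{0}) :
    ∀ (l : List ℕ) (n : ℕ), (l.map fun a : ℕ => Ordinal.omega0 ^ (a : Ordinal.{0})).sum = o →
      l.Pairwise (· ≥ ·) → l.length ≤ n → h n ≤ lexHilbert l n →
      ∃ l : List ℕ, l.Pairwise (· ≥ ·) ∧ ∀ᶠ n in atTop, h n = lexHilbert l n := by
  induction o using WellFoundedLT.induction with
  | ind o ih =>
  intro l n ho hl hn hle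
  have hmono : ∀ m, n ≤ m → h m ≤ lexHilbert l m := by
    intro m hm
    induction m, hm using Nat.le_induction with
    | base => exact hle
    | succ m hm ihm => exact le_succ hl (by omega) ihm (hh m)
  by_cases hlt : ∃ m, n ≤ m ∧ h m < lexHilbert l m
  swap
  · push Not at hlt
    exact ⟨l, hl, eventually_atTop.2 ⟨n, fun m hm => le_antisymm (hmono m hm) (hlt m hm)⟩⟩
  obtain ⟨m, hm, hlt⟩ := hlt
  rcases List.eq_nil_or_concat' l with rfl | ⟨p, a, rfl⟩
  · simp [lexHilbert] at hlt
  have hp := List.pairwise_append.1 hl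
  simp only [List.length_append, List.length_singleton] at hn
  rw [append] at hlt
  simp only [lexHilbert, add_zero] at hlt
  cases a with
  | zero =>
    refine ih _ ?_ p m rfl hp.1 (by omega) (by simpa [Nat.lt_succ_iff] using hlt)
    rw [← ho, List.map_append, List.sum_append]
    simp
  | succ b =>
    refine ih _ ?_ (p ++ List.replicate (m - p.length) b) m rfl ?_ ?_ ?_
    · rw [← ho, List.map_append, List.sum_append, List.map_append, List.sum_append]
      gcongr
      rw [List.map_replicate, List.sum_replicate]
      simp only [List.map_cons, List.map_nil, List.sum_cons, List.sum_nil, add_zero]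
      rw [Nat.cast_succ, ← Order.succ_eq_add_one, Ordinal.opow_succ]
      rw [Ordinal.nsmul_eq_mul]
      exact mul_lt_mul_of_pos_left (Ordinal.natCast_lt_omega0 _) (Ordinal.opow_pos _ Ordinal.omega0_pos)
    · refine List.pairwise_append.2 ⟨hp.1, by simp [List.pairwise_replicate], ?_⟩
      intro x hx y hy
      have h1 := hp.2.2 x hx (b + 1) (by simp)
      have h2 := List.eq_of_mem_replicate hy
      show y ≤ x
      have : b + 1 ≤ x := h1
      omega
    · simp; omega
    · have := replicate b (m - p.length)
      rw [append]
      omega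

/-- A sequence satisfying Macaulay's growth condition is eventually the Hilbert function of a
lexicographic quotient. -/
theorem exists_eventually_eq {h : ℕ → ℕ}
    (hh : ∀ n, h (n + 1) ≤ h n + macaulayLower (n + 1) (h (n + 1))) :
    ∃ l : List ℕ, l.Pairwise (· ≥ ·) ∧ ∀ᶠ n in atTop, h n = lexHilbert l n :=
  -- In degree one the list `[h 1]` takes the value `h 1 + 1`.
  exists_eventually_eq_aux hh _ [h 1] 1 rfl (by simp) (by simp) (by simp [lexHilbert])

end lexHilbert

/-! ### Generic ranks of linear families. -/

section GenericRank

variable {κ : Type u} [Field κ]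

/-- The rank of `a + t b` is at least the rank of `a` for all but finitely many `t`. -/
theorem finite_setOf_finrank_range_lt {V U : Type*} [AddCommGroup V] [Module κ V]
    [AddCommGroup U] [Module κ U] [FiniteDimensional κ U] (a b : V →ₗ[κ] U) :
    {t : κ | Module.finrank κ (LinearMap.range (a + t • b)) <
      Module.finrank κ (LinearMap.range a)}.Finite := by
  obtain ⟨s, hs⟩ := a.rangeRestrict.exists_rightInverse_of_surjective a.range_rangeRestrict
  obtain ⟨p, hp⟩ := (LinearMap.range a).subtype.exists_leftInverse_of_injective
    (Submodule.ker_subtype _)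
  -- A section and a projection compress `a + t b` to `1 + t c` on the range of `a`. The rank can
  -- drop only if this is not injective, that is, if `-t⁻¹` is an eigenvalue of `c`.
  let c : Module.End κ (LinearMap.range a) := p ∘ₗ b ∘ₗ s
  have hc : ∀ t : κ, ∀ x, (p ∘ₗ (a + t • b) ∘ₗ s) x = x + t • c x := by
    intro t x
    have h1 : a (s x) = x := congrArg Subtype.val (LinearMap.congr_fun hs x)
    have h2 : p x = x := LinearMap.congr_fun hp x
    simp [c, h1, h2]
  refine (c.finite_hasEigenvalue.image fun μ => -μ⁻¹).subset fun t ht => ?_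
  rw [Set.mem_ofPred_eq] at ht
  have hni : ¬ Function.Injective (p ∘ₗ (a + t • b) ∘ₗ s) := by
    intro hinj
    refine absurd ht (not_lt.2 ?_)
    have h1 := LinearMap.finrank_range_of_inj hinj
    rw [← h1, LinearMap.range_comp]
    refine (Submodule.finrank_map_le _ _).trans (Submodule.finrank_mono ?_)
    rw [LinearMap.range_comp]
    exact LinearMap.map_le_range
  rw [← LinearMap.ker_eq_bot, Submodule.eq_bot_iff] at hni
  push Not at hni
  obtain ⟨x, hx, hx0⟩ := hni
  rw [LinearMap.mem_ker, hc] at hx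
  have ht0 : t ≠ 0 := by
    rintro rfl
    simp [hx0] at hx
  refine ⟨-t⁻¹, Module.End.hasEigenvalue_of_hasEigenvector (x := x) ⟨?_, hx0⟩, by simp⟩
  rw [Module.End.mem_eigenspace_iff, ← sub_eq_zero]
  have h3 := congrArg (t⁻¹ • ·) hx
  simp only [smul_add, smul_smul, inv_mul_cancel₀ ht0, one_smul, smul_zero] at h3
  rw [neg_smul, sub_neg_eq_add, add_comm, h3]

/-- Two linear families of linear maps over an infinite field can be simultaneously specialized
without decreasing given ranks. -/
theorem exists_finrank_range_le_and_le [Infinite κ] {W V₁ U₁ V₂ U₂ : Type*}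
    [AddCommGroup W] [Module κ W]
    [AddCommGroup V₁] [Module κ V₁] [AddCommGroup U₁] [Module κ U₁] [FiniteDimensional κ U₁]
    [AddCommGroup V₂] [Module κ V₂] [AddCommGroup U₂] [Module κ U₂] [FiniteDimensional κ U₂]
    (f₁ : W →ₗ[κ] V₁ →ₗ[κ] U₁) (f₂ : W →ₗ[κ] V₂ →ₗ[κ] U₂) (w₁ w₂ : W) :
    ∃ w, Module.finrank κ (LinearMap.range (f₁ w₁)) ≤ Module.finrank κ (LinearMap.range (f₁ w)) ∧
      Module.finrank κ (LinearMap.range (f₂ w₂)) ≤ Module.finrank κ (LinearMap.range (f₂ w)) := by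
  have h1 := finite_setOf_finrank_range_lt (f₁ w₁) (f₁ w₂)
  have h2 := (finite_setOf_finrank_range_lt (f₂ w₂) (f₂ w₁)).image fun t => t⁻¹
  obtain ⟨t, ht⟩ := ((h1.union h2).union (Set.finite_singleton (0 : κ))).exists_notMem
  simp only [Set.mem_union, Set.mem_singleton_iff, not_or] at ht
  obtain ⟨⟨ht1, ht2⟩, ht0⟩ := ht
  refine ⟨w₁ + t • w₂, ?_, ?_⟩
  · rw [map_add, map_smul]
    exact not_lt.1 ht1
  · have h3 : ¬ Module.finrank κ (LinearMap.range (f₂ w₂ + t⁻¹ • f₂ w₁)) <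
        Module.finrank κ (LinearMap.range (f₂ w₂)) := fun h => ht2 ⟨t⁻¹, h, inv_inv t⟩
    have h4 : f₂ (w₁ + t • w₂) = t • (f₂ w₂ + t⁻¹ • f₂ w₁) := by
      rw [map_add, map_smul, smul_add, smul_smul, mul_inv_cancel₀ ht0, one_smul, add_comm]
    rw [h4, LinearMap.range_smul _ _ ht0]
    exact not_lt.1 h3

end GenericRank

/-! ### Graded modules and Green's theorem. -/

/-- A graded module over the symmetric algebra of `W`, generated in degree zero, with
finite-dimensional homogeneous components. -/
structure GradedSystem (κ : Type u) [Field κ] (W : Type v) [AddCommGroup W] [Module κ W] where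
  M : ℕ → Type u
  [addCommGroup : ∀ n, AddCommGroup (M n)]
  [module : ∀ n, Module κ (M n)]
  [finite : ∀ n, FiniteDimensional κ (M n)]
  act : ∀ n, W →ₗ[κ] M n →ₗ[κ] M (n + 1)
  comm : ∀ n v w x, act (n + 1) v (act n w x) = act (n + 1) w (act n v x)
  generate : ∀ n, ⨆ w, LinearMap.range (act n w) = ⊤

namespace GradedSystem

attribute [instance] addCommGroup module finite

variable {κ : Type u} [Field κ] {W : Type v} [AddCommGroup W] [Module κ W]

/-- The submodule `w M` of a graded module. -/
def mulRange (S : GradedSystem κ W) (w : W) : ∀ n, Submodule κ (S.M n)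
  | 0 => ⊥
  | n + 1 => LinearMap.range (S.act n w)

theorem mulRange_le_comap (S : GradedSystem κ W) (w v : W) (n : ℕ) :
    S.mulRange w n ≤ (S.mulRange w (n + 1)).comap (S.act n v) := by
  cases n with
  | zero => exact bot_le
  | succ n =>
    rintro _ ⟨x, rfl⟩
    exact ⟨S.act n v x, S.comm n w v x⟩

theorem range_le_comap (S : GradedSystem κ W) (w v : W) (n : ℕ) :
    LinearMap.range (S.act n w) ≤ (LinearMap.range (S.act (n + 1) w)).comap (S.act (n + 1) v) :=
  S.mulRange_le_comap w v (n + 1)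

/-- The quotient `M / w M` of a graded module. -/
def quot (S : GradedSystem κ W) (w : W) : GradedSystem κ W where
  M n := S.M n ⧸ S.mulRange w n
  act n :=
    { toFun := fun v => Submodule.mapQ _ _ (S.act n v) (S.mulRange_le_comap w v n)
      map_add' := fun v v' => by ext x; simp
      map_smul' := fun c v => by ext x; simp }
  comm n v v' x := by
    obtain ⟨x, rfl⟩ := Submodule.mkQ_surjective _ x
    simp [S.comm n v v' x]
  generate n := by
    have h : ∀ v, LinearMap.range (Submodule.mapQ _ _ (S.act n v) (S.mulRange_le_comap w v n)) =
        (LinearMap.range (S.act n v)).map (Submodule.mkQ (S.mulRange w (n + 1))) := fun v => by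
      rw [Submodule.range_mapQ]
    simp only [LinearMap.coe_mk, AddHom.coe_mk, h]
    rw [← Submodule.map_iSup, S.generate, Submodule.map_top, Submodule.range_mkQ]

theorem range_quot_act (S : GradedSystem κ W) (w v : W) (n : ℕ) :
    LinearMap.range ((S.quot w).act n v) =
      (LinearMap.range (S.act n v)).map (Submodule.mkQ (S.mulRange w (n + 1))) :=
  Submodule.range_mapQ _ _ _ (S.mulRange_le_comap w v n)

/-- The image `w M` of a graded module, shifted so that it is generated in degree zero. -/
def image (S : GradedSystem κ W) (w : W) : GradedSystem κ W where
  M n := LinearMap.range (S.act n w)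
  act n :=
    { toFun := fun v => (S.act (n + 1) v).restrict (S.range_le_comap w v n)
      map_add' := fun v v' => by ext x; simp
      map_smul' := fun c v => by ext x; simp }
  comm n v v' x := by
    ext
    simp [S.comm]
  generate n := by
    rw [eq_top_iff]
    rintro ⟨_, x, rfl⟩ -
    have hx : x ∈ ⨆ v, LinearMap.range (S.act n v) := by rw [S.generate]; trivial
    induction hx using Submodule.iSup_induction' with
    | mem v x hx =>
      obtain ⟨y, rfl⟩ := hx
      refine Submodule.mem_iSup_of_mem v ⟨⟨S.act n w y, y, rfl⟩, ?_⟩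
      ext
      simp [S.comm]
    | zero =>
      convert Submodule.zero_mem _ using 1
      ext
      simp
    | add x y hx hy ihx ihy =>
      convert Submodule.add_mem _ ihx ihy using 1
      ext
      simp

end GradedSystem

namespace GradedSystem

variable {κ : Type u} [Field κ] {W : Type v} [AddCommGroup W] [Module κ W]

open Module LinearMap

theorem finrank_succ_eq_zero_of_act_eq_zero (S : GradedSystem κ W) (n : ℕ) (h : ∀ w, S.act n w = 0) :
    finrank κ (S.M (n + 1)) = 0 := by
  have := S.generate n
  simp only [h, range_zero, iSup_const] at this
  rw [← finrank_top, ← this, finrank_bot]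

theorem exists_finrank_range_max (S : GradedSystem κ W) (n : ℕ) :
    ∃ w, ∀ v, finrank κ (range (S.act n v)) ≤ finrank κ (range (S.act n w)) := by
  have hb : ∀ k ∈ Set.range fun w => finrank κ (range (S.act n w)), k ≤ finrank κ (S.M (n + 1)) := by
    rintro _ ⟨w, rfl⟩
    exact Submodule.finrank_le _
  obtain ⟨w, hw⟩ := Nat.sSup_mem (Set.range_nonempty fun w => finrank κ (range (S.act n w)))
    ⟨_, hb⟩
  refine ⟨w, fun v => ?_⟩
  simp only at hw
  rw [hw]
  exact le_csSup ⟨_, hb⟩ ⟨v, rfl⟩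

/-- The generic rank inequality used in the proof of Green's theorem. -/
theorem finrank_inequality (S : GradedSystem κ W) (n : ℕ) (l w : W)
    (hl : finrank κ (range (S.act (n + 1) w)) ≤ finrank κ (range (S.act (n + 1) l))) :
    finrank κ (range ((S.image l).act n w)) + finrank κ (range ((S.quot l).act (n + 1) w)) ≤
      finrank κ (range (S.act (n + 1) l)) := by
  set X := range (S.act (n + 1) l) with hX
  set Y := range (S.act (n + 1) w) with hY
  -- The image of `w` on `l M` lies in `X ⊓ Y`, and on `M / l M` it is `(X ⊔ Y) / X`. The two ranks
  -- thus add up to at most `dim Y`, hence at most `dim X`.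
  have h1 : finrank κ (range ((S.image l).act n w)) ≤ finrank κ ↥(X ⊓ Y) := by
    refine LinearMap.finrank_le_finrank_of_injective
      (f := (X.subtype ∘ₗ (range ((S.image l).act n w)).subtype).codRestrict (X ⊓ Y) ?_) ?_
    · rintro ⟨_, y, rfl⟩
      exact ⟨Subtype.property _, y.1, rfl⟩
    · rw [← ker_eq_bot, ker_codRestrict, ker_eq_bot]
      exact (Subtype.val_injective).comp Subtype.val_injective
  have h2 : finrank κ (range ((S.quot l).act (n + 1) w)) + finrank κ X ≤ finrank κ ↥(X ⊔ Y) := by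
    have h3 : range ((S.quot l).act (n + 1) w) = (X ⊔ Y).map X.mkQ := by
      rw [Submodule.map_sup, Submodule.mkQ_map_self, bot_sup_eq]
      exact S.range_quot_act l w (n + 1)
    have h4 := finrank_range_add_finrank_ker (X.mkQ.domRestrict (X ⊔ Y))
    rw [range_domRestrict, ker_domRestrict, Submodule.ker_mkQ,
      (Submodule.comapSubtypeEquivOfLe (le_sup_left : X ≤ X ⊔ Y)).finrank_eq] at h4
    rw [h3]
    exact h4.le
  have h3 := Submodule.finrank_sup_add_finrank_inf_eq X Y
  omega

/-- **Green's hyperplane restriction theorem** for modules generated in degree zero. -/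
theorem exists_finrank_le [Infinite κ] (n : ℕ) : ∀ S : GradedSystem κ W,
    ∃ w, finrank κ (S.M (n + 1)) ≤ finrank κ (range (S.act n w)) +
      macaulayLower (n + 1) (finrank κ (S.M (n + 1))) := by
  induction n with
  | zero =>
    intro S
    rw [show macaulayLower (0 + 1) _ = _ from macaulayLower.one_left _]
    by_cases h : ∀ w, S.act 0 w = 0
    · have := S.finrank_succ_eq_zero_of_act_eq_zero 0 h
      exact ⟨0, by omega⟩
    · push Not at h
      obtain ⟨w, hw⟩ := h
      have : 0 < finrank κ (range (S.act 0 w)) := by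
        rw [Module.finrank_pos_iff, Submodule.nontrivial_iff_ne_bot, Ne, range_eq_bot]
        exact hw
      exact ⟨w, by omega⟩
  | succ n ih =>
    suffices H : ∀ h, ∀ S : GradedSystem κ W, finrank κ (S.M (n + 1 + 1)) = h →
        ∃ w, h ≤ finrank κ (range (S.act (n + 1) w)) + macaulayLower (n + 1 + 1) h from
      fun S => H _ S rfl
    intro h
    induction h using Nat.strong_induction_on with
    | h h ihh =>
    intro S hS
    obtain ⟨l, hl⟩ := S.exists_finrank_range_max (n + 1)
    refine ⟨l, ?_⟩
    set r := finrank κ (range (S.act (n + 1) l)) with hr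
    rcases Nat.eq_zero_or_pos r with hr0 | hr0
    · have : finrank κ (S.M (n + 1 + 1)) = 0 := S.finrank_succ_eq_zero_of_act_eq_zero (n + 1) fun w => by
        have := hl w
        rw [hr0, Nat.le_zero, Submodule.finrank_eq_zero, range_eq_bot] at this
        exact this
      omega
    have hrh : r ≤ h := hS ▸ Submodule.finrank_le _
    have hq : finrank κ ((S.quot l).M (n + 1 + 1)) = h - r := by
      have := Submodule.finrank_quotient_add_finrank (range (S.act (n + 1) l))
      have h1 : finrank κ ((S.quot l).M (n + 1 + 1)) =
        finrank κ (S.M (n + 1 + 1) ⧸ range (S.act (n + 1) l)) := rfl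
      omega
    have hi : finrank κ ((S.image l).M (n + 1)) = r := rfl
    obtain ⟨w₁, h₁⟩ := ih (S.image l)
    obtain ⟨w₂, h₂⟩ := ihh (h - r) (by omega) (S.quot l) hq
    -- A single `w` must serve both `l M`, one degree lower, and `M / l M`, of smaller dimension.
    -- With `c = h - r`, adding the two bounds gives `c ≤ c_⟨n+2⟩ + (h - c)_⟨n+1⟩`, the hypothesis
    -- of the numerical lemma.
    obtain ⟨w, hw₁, hw₂⟩ := exists_finrank_range_le_and_le ((S.image l).act n)
      ((S.quot l).act (n + 1)) w₁ w₂
    have h3 := S.finrank_inequality n l w (hl w)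
    rw [hi] at h₁
    have h4 := macaulayLower.le_of_le_add (n := n + 1) (h := h) (c := h - r) (by omega) (by
      rw [Nat.sub_sub_self hrh]
      omega)
    omega

theorem finrank_succ_le [Infinite κ] (S : GradedSystem κ W) (n : ℕ) :
    finrank κ (S.M (n + 1)) ≤ finrank κ (S.M n) +
      macaulayLower (n + 1) (finrank κ (S.M (n + 1))) := by
  obtain ⟨w, hw⟩ := S.exists_finrank_le n
  have := finrank_range_le (S.act n w)
  omega

/-- Dividing out the first of `k + 1` operators leaves a module generated by `k` of them; the
sequence `M n → M (n + 1) → (M / s₀ M) (n + 1)` matches Pascal's rule. -/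
theorem finrank_le_choose (k : ℕ) : ∀ (S : GradedSystem κ W) (s : Fin (k + 1) → W),
    (∀ n, ⨆ i, range (S.act n (s i)) = ⊤) → ∀ n,
    finrank κ (S.M n) ≤ finrank κ (S.M 0) * (n + k).choose k := by
  induction k with
  | zero =>
    intro S s hs n
    simp only [add_zero, Nat.choose_zero_right, mul_one]
    induction n with
    | zero => exact le_rfl
    | succ n ihn =>
      have := hs n
      have h0 : ∀ i : Fin (0 + 1), s i = s 0 := fun i => by rw [Fin.fin_one_eq_zero i]
      simp only [h0, ciSup_const] at this
      refine le_trans ?_ ihn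
      rw [← finrank_top, ← this]
      exact finrank_range_le _
  | succ k ih =>
    intro S s hs n
    have hq : ∀ n, ⨆ i : Fin (k + 1), range ((S.quot (s 0)).act n (s i.succ)) = ⊤ := by
      intro n
      have h1 := congrArg (Submodule.map (Submodule.mkQ (S.mulRange (s 0) (n + 1)))) (hs n)
      rw [Submodule.map_top, Submodule.range_mkQ, Submodule.map_iSup] at h1
      rw [eq_top_iff]
      refine h1.ge.trans (iSup_le fun i => ?_)
      refine Fin.cases ?_ (fun i => ?_) i
      · exact le_of_eq_of_le (Submodule.mkQ_map_self _) bot_le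
      · rw [← range_quot_act]
        exact le_iSup (fun i : Fin (k + 1) => range ((S.quot (s 0)).act n (s i.succ))) i
    replace hq := ih (S.quot (s 0)) (fun i => s i.succ) hq
    have h0 : finrank κ ((S.quot (s 0)).M 0) = finrank κ (S.M 0) :=
      (Submodule.quotEquivOfEqBot _ rfl).finrank_eq
    induction n with
    | zero => simp
    | succ n ihn =>
      have h1 := Submodule.finrank_quotient_add_finrank (range (S.act n (s 0)))
      have h2 := hq (n + 1)
      have h3 : finrank κ ((S.quot (s 0)).M (n + 1)) =
        finrank κ (S.M (n + 1) ⧸ range (S.act n (s 0))) := rfl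
      have h4 := finrank_range_le (S.act n (s 0))
      have h5 : (n + 1 + (k + 1)).choose (k + 1) = (n + 1 + k).choose k +
          (n + (k + 1)).choose (k + 1) := by
        rw [show n + 1 + (k + 1) = (n + 1 + k) + 1 by ring, Nat.choose_succ_succ',
          show n + (k + 1) = n + 1 + k by ring]
      rw [h5, mul_add]
      rw [h0] at h2
      omega

end GradedSystem

/-- A graded system from finitely many commuting operators. -/
def GradedSystem.ofOperators {κ : Type u} [Field κ] {ι : Type v} [Fintype ι] [DecidableEq ι]
    (M : ℕ → Type u) [∀ n, AddCommGroup (M n)] [∀ n, Module κ (M n)]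
    [∀ n, FiniteDimensional κ (M n)] (op : ι → ∀ n, M n →ₗ[κ] M (n + 1))
    (comm : ∀ i j n x, op i (n + 1) (op j n x) = op j (n + 1) (op i n x))
    (generate : ∀ n, ⨆ i, LinearMap.range (op i n) = ⊤) : GradedSystem κ (ι → κ) where
  M := M
  act n := Fintype.linearCombination κ fun i => op i n
  comm n v w x := by
    simp only [Fintype.linearCombination_apply, LinearMap.sum_apply, LinearMap.smul_apply,
      map_sum, map_smul, Finset.smul_sum]
    rw [Finset.sum_comm]
    refine Finset.sum_congr rfl fun i _ => Finset.sum_congr rfl fun j _ => ?_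
    rw [comm, smul_comm]
  generate n := by
    rw [eq_top_iff, ← generate n]
    refine iSup_le fun i => le_trans (le_of_eq ?_) (le_iSup _ (Pi.single i 1))
    rw [Fintype.linearCombination_apply_single, one_smul]

theorem GradedSystem.ofOperators_act_single {κ : Type u} [Field κ] {ι : Type v} [Fintype ι]
    [DecidableEq ι] (M : ℕ → Type u) [∀ n, AddCommGroup (M n)] [∀ n, Module κ (M n)]
    [∀ n, FiniteDimensional κ (M n)] (op : ι → ∀ n, M n →ₗ[κ] M (n + 1))
    (comm : ∀ i j n x, op i (n + 1) (op j n x) = op j (n + 1) (op i n x))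
    (generate : ∀ n, ⨆ i, LinearMap.range (op i n) = ⊤) (n : ℕ) (i : ι) :
    (GradedSystem.ofOperators M op comm generate).act n (Pi.single i 1) = op i n := by
  show Fintype.linearCombination κ (fun i => op i n) (Pi.single i 1) = op i n
  rw [Fintype.linearCombination_apply_single, one_smul]

/-! ### The refined filtration of a local ring. -/

section LocalRing

variable {A : Type u} [CommRing A] [IsLocalRing A]

open IsLocalRing

/-- The bifiltration refining the `I`-adic filtration of a local ring. -/
def refinedPower (I : Ideal A) (i j : ℕ) : Ideal A := I ^ i * (maximalIdeal A ^ j ⊔ I)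

theorem refinedPower_succ_right_le (I : Ideal A) (i j : ℕ) :
    refinedPower I i (j + 1) ≤ refinedPower I i j :=
  Ideal.mul_mono_right (sup_le_sup_right (Ideal.pow_le_pow_right j.le_succ) I)

theorem maximalIdeal_mul_refinedPower_le (I : Ideal A) (i j : ℕ) :
    maximalIdeal A * refinedPower I i j ≤ refinedPower I i (j + 1) := by
  unfold refinedPower
  rw [mul_left_comm, Ideal.mul_sup, ← pow_succ']
  exact Ideal.mul_mono_right (sup_le_sup_left Ideal.mul_le_right _)

theorem refinedPower_succ_left (I : Ideal A) (i j : ℕ) :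
    refinedPower I (i + 1) j = I * refinedPower I i j := by
  rw [refinedPower, refinedPower, pow_succ', mul_assoc]

theorem refinedPower_zero_right (I : Ideal A) (i : ℕ) : refinedPower I i 0 = I ^ i := by
  rw [refinedPower, pow_zero, Ideal.one_eq_top, top_sup_eq, Ideal.mul_top]

theorem refinedPower_right_eq {I : Ideal A} {J : ℕ} (hJ : maximalIdeal A ^ J ≤ I) (i : ℕ) :
    refinedPower I i J = I ^ (i + 1) := by
  rw [refinedPower, sup_eq_right.2 hJ, pow_succ]

/-- A graded piece of the bifiltration `refinedPower`. -/
def RefinedPiece (I : Ideal A) (i j : ℕ) : Type u :=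
  (refinedPower I i j) ⧸ (refinedPower I i (j + 1)).submoduleOf (refinedPower I i j)

namespace RefinedPiece

noncomputable instance (I : Ideal A) (i j : ℕ) : AddCommGroup (RefinedPiece I i j) :=
  inferInstanceAs (AddCommGroup (_ ⧸ _))

noncomputable instance (I : Ideal A) (i j : ℕ) : Module A (RefinedPiece I i j) :=
  inferInstanceAs (Module A (_ ⧸ (refinedPower I i (j + 1)).submoduleOf (refinedPower I i j)))

/-- The class of an element in a graded piece. -/
noncomputable def mk (I : Ideal A) (i j : ℕ) : refinedPower I i j →ₗ[A] RefinedPiece I i j :=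
  Submodule.mkQ _

theorem mk_surjective (I : Ideal A) (i j : ℕ) : Function.Surjective (mk I i j) :=
  Submodule.mkQ_surjective _

theorem ker_mk (I : Ideal A) (i j : ℕ) : LinearMap.ker (mk I i j) =
    (refinedPower I i (j + 1)).submoduleOf (refinedPower I i j) :=
  Submodule.ker_mkQ _

theorem isTorsionBySet (I : Ideal A) (i j : ℕ) :
    Module.IsTorsionBySet A (RefinedPiece I i j) (maximalIdeal A) := by
  rintro x ⟨a, ha⟩
  obtain ⟨x, rfl⟩ := mk_surjective I i j x
  show a • mk I i j x = 0
  rw [← map_smul, ← LinearMap.mem_ker, ker_mk]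
  exact maximalIdeal_mul_refinedPower_le I i j (Ideal.mul_mem_mul ha x.2)

noncomputable instance (I : Ideal A) (i j : ℕ) : Module (ResidueField A) (RefinedPiece I i j) :=
  (isTorsionBySet I i j).module

instance (I : Ideal A) (i j : ℕ) : IsScalarTower A (ResidueField A) (RefinedPiece I i j) :=
  IsScalarTower.of_algebraMap_smul fun a x => (isTorsionBySet I i j).mk_smul a x

instance [IsNoetherianRing A] (I : Ideal A) (i j : ℕ) :
    Module.Finite A (RefinedPiece I i j) :=
  Module.Finite.of_surjective (mk I i j) (mk_surjective I i j)

instance [IsNoetherianRing A] (I : Ideal A) (i j : ℕ) :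
    FiniteDimensional (ResidueField A) (RefinedPiece I i j) :=
  Module.Finite.of_restrictScalars_finite A _ _

theorem length_eq [IsNoetherianRing A] (I : Ideal A) (i j : ℕ) :
    Module.length A (RefinedPiece I i j) =
      Module.finrank (ResidueField A) (RefinedPiece I i j) := by
  rw [← Module.length_eq_finrank, Module.length_eq_of_surjective (S := A) (R := ResidueField A)]
  exact residue_surjective

theorem mul_mem {I : Ideal A} {a x : A} (ha : a ∈ I) {i j : ℕ} (hx : x ∈ refinedPower I i j) :
    a * x ∈ refinedPower I (i + 1) j := by
  rw [refinedPower_succ_left]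
  exact Ideal.mul_mem_mul ha hx

/-- Multiplication by an element of `I` on graded pieces, as an `A`-linear map. -/
noncomputable def mulAux {I : Ideal A} {a : A} (ha : a ∈ I) (i j : ℕ) :
    RefinedPiece I i j →ₗ[A] RefinedPiece I (i + 1) j :=
  Submodule.mapQ _ _ ((LinearMap.mulLeft A a).restrict fun _ hx => mul_mem ha hx)
    fun _ hx => mul_mem (i := i) (j := j + 1) ha hx

/-- Multiplication by an element of `I` on graded pieces. -/
noncomputable def mul {I : Ideal A} {a : A} (ha : a ∈ I) (i j : ℕ) :
    RefinedPiece I i j →ₗ[ResidueField A] RefinedPiece I (i + 1) j :=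
  (mulAux ha i j).extendScalarsOfSurjective (residue_surjective (R := A))

theorem mul_mk {I : Ideal A} {a : A} (ha : a ∈ I) (i j : ℕ) (x : refinedPower I i j) :
    mul ha i j (mk I i j x) = mk I (i + 1) j ⟨a * x, mul_mem ha x.2⟩ := rfl

theorem mul_comm' {I : Ideal A} {a b : A} (ha : a ∈ I) (hb : b ∈ I) (i j : ℕ)
    (x : RefinedPiece I i j) :
    mul ha (i + 1) j (mul hb i j x) = mul hb (i + 1) j (mul ha i j x) := by
  obtain ⟨x, rfl⟩ := mk_surjective I i j x
  simp only [mul_mk]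
  congr 2
  exact mul_left_comm _ _ _

/-- Each step of the filtration satisfies `F (i + 1) j = I · F i j`, so generators of `I` generate
the next pieces. -/
theorem iSup_range_mul {I : Ideal A} {ι : Type*} (a : ι → A) (ha : Ideal.span (Set.range a) = I)
    (i j : ℕ) : ⨆ s, LinearMap.range
      (mul (I := I) (ha ▸ Ideal.subset_span (Set.mem_range_self s) : a s ∈ I) i j) = ⊤ := by
  rw [eq_top_iff]
  rintro x -
  obtain ⟨⟨x, hx⟩, rfl⟩ := mk_surjective I (i + 1) j x
  have hx' : x ∈ Ideal.span (Set.range a) • refinedPower I i j := by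
    rw [refinedPower_succ_left] at hx
    rwa [ha]
  induction hx' using Submodule.smul_induction_on' with
  | smul r hr y hy =>
    induction hr using Submodule.span_induction with
    | mem r hr =>
      obtain ⟨s, rfl⟩ := hr
      exact Submodule.mem_iSup_of_mem s ⟨mk I i j ⟨y, hy⟩, mul_mk _ _ _ _⟩
    | zero =>
      convert Submodule.zero_mem _ using 1
      rw [← map_zero (mk I (i + 1) j)]
      congr 2
      exact zero_smul _ y
    | add r r' hr hr' h1 h2 =>
      have hr1 : r ∈ I := ha ▸ hr
      have hr2 : r' ∈ I := ha ▸ hr'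
      convert Submodule.add_mem _ (h1 (mul_mem hr1 hy)) (h2 (mul_mem hr2 hy)) using 1
      rw [← map_add]
      congr 2
      exact add_smul r r' y
    | smul c r hr h =>
      have hr1 : r ∈ I := ha ▸ hr
      convert Submodule.smul_mem _ (residue A c) (h (mul_mem hr1 hy)) using 1
      rw [show ∀ z : RefinedPiece I (i + 1) j, residue A c • z = c • z from
        fun z => algebraMap_smul _ c z, ← map_smul]
      congr 2
      exact smul_assoc c r y
  | add x hx₁ y hy₁ h1 h2 =>
    rw [ha] at hx₁ hy₁
    have hx' : x ∈ refinedPower I (i + 1) j := by rwa [refinedPower_succ_left]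
    have hy' : y ∈ refinedPower I (i + 1) j := by rwa [refinedPower_succ_left]
    convert Submodule.add_mem _ (h1 hx') (h2 hy') using 1
    rw [← map_add]
    rfl

end RefinedPiece

theorem length_quotient_eq_add {A : Type*} [CommRing A] {a b : Ideal A} (hab : b ≤ a) :
    Module.length A (A ⧸ b) = Module.length A (a ⧸ b.submoduleOf a) + Module.length A (A ⧸ a) := by
  refine Module.length_eq_add_of_exact (Submodule.mapQ _ _ a.subtype le_rfl)
    (Submodule.factor hab) ?_ (Submodule.factor_surjective hab) ?_
  · rw [injective_iff_map_eq_zero]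
    intro x hx
    obtain ⟨x, rfl⟩ := Submodule.mkQ_surjective _ x
    exact (Submodule.Quotient.mk_eq_zero _).2 ((Submodule.Quotient.mk_eq_zero b).1 hx)
  · intro y
    obtain ⟨y, rfl⟩ := Submodule.mkQ_surjective _ y
    constructor
    · intro hy
      exact ⟨Submodule.Quotient.mk ⟨y, (Submodule.Quotient.mk_eq_zero a).1 hy⟩, rfl⟩
    · rintro ⟨x, hx⟩
      obtain ⟨x, rfl⟩ := Submodule.mkQ_surjective _ x
      rw [← hx]
      exact (Submodule.Quotient.mk_eq_zero a).2 x.2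

/-- Additivity of length along the refined filtration, which goes from `I^i` to `I^(i+1)` in `J`
steps. -/
theorem length_quotient_pow_succ [IsNoetherianRing A] {I : Ideal A} {J : ℕ}
    (hJ : maximalIdeal A ^ J ≤ I) (n : ℕ) :
    Module.length A (A ⧸ I ^ (n + 1)) = ∑ i : Fin (n + 1), ∑ j : Fin J,
      Module.length A (RefinedPiece I i j) := by
  have h1 : ∀ i k, Module.length A (A ⧸ refinedPower I i k) =
      ∑ j ∈ Finset.range k, Module.length A (RefinedPiece I i j) +
        Module.length A (A ⧸ I ^ i) := by
    intro i k
    induction k with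
    | zero => rw [refinedPower_zero_right]; simp
    | succ k ih =>
      rw [length_quotient_eq_add (refinedPower_succ_right_le I i k), ih, Finset.sum_range_succ,
        ← add_assoc, add_comm (Module.length A _)]
      rfl
  rw [Fin.sum_univ_eq_sum_range (fun i => ∑ j : Fin J, Module.length A (RefinedPiece I i j))]
  have h2 : ∀ n, Module.length A (A ⧸ I ^ n) = ∑ i ∈ Finset.range n, ∑ j : Fin J,
      Module.length A (RefinedPiece I i j) := by
    intro n
    induction n with
    | zero =>
      rw [pow_zero, Ideal.one_eq_top]
      simp [Module.length_eq_zero]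
    | succ n ih =>
      rw [← refinedPower_right_eq hJ, h1, ih, Finset.sum_range_succ, add_comm,
        Fin.sum_univ_eq_sum_range (fun j => Module.length A (RefinedPiece I n j))]
  exact h2 _

end LocalRing

/-! ### The graded module whose Hilbert function is the Hilbert-Samuel function. -/

section LocalRing

variable {A : Type u} [CommRing A] [IsLocalRing A]

open IsLocalRing

/-- The sum of the graded pieces of degree at most `n`. -/
abbrev RefinedSum (I : Ideal A) (J n : ℕ) : Type u :=
  (i : Fin (n + 1)) → (j : Fin J) → RefinedPiece I i j

namespace RefinedSum

/-- Multiplication by an element of `I`, raising degrees by one. -/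
noncomputable def shift {I : Ideal A} {a : A} (ha : a ∈ I) (J n : ℕ) :
    RefinedSum I J n →ₗ[ResidueField A] RefinedSum I J (n + 1) where
  toFun f := Fin.cons (α := fun i : Fin (n + 1 + 1) => (j : Fin J) → RefinedPiece I i j) 0
    fun i j => RefinedPiece.mul ha i j (f i j)
  map_add' f g := by
    ext i j
    refine Fin.cases (zero_add _).symm (fun i => ?_) i
    simp
  map_smul' c f := by
    ext i j
    refine Fin.cases (smul_zero c).symm (fun i => ?_) i
    simp

/-- The inclusion of the sum of the pieces of degree at most `n` into the one for `n + 1`. -/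
noncomputable def incl (I : Ideal A) (J n : ℕ) :
    RefinedSum I J n →ₗ[ResidueField A] RefinedSum I J (n + 1) where
  toFun f := Fin.snoc (α := fun i : Fin (n + 1 + 1) => (j : Fin J) → RefinedPiece I i j) f 0
  map_add' f g := by
    ext i j
    refine Fin.lastCases ?_ (fun i => ?_) i <;> simp
  map_smul' c f := by
    ext i j
    refine Fin.lastCases ?_ (fun i => ?_) i <;> simp

/-- The inclusion of the pieces of top degree. -/
noncomputable def top (I : Ideal A) (J n : ℕ) :
    ((j : Fin J) → RefinedPiece I n j) →ₗ[ResidueField A] RefinedSum I J n where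
  toFun g := Fin.snoc (α := fun i : Fin (n + 1) => (j : Fin J) → RefinedPiece I i j) 0 g
  map_add' f g := by
    ext i j
    refine Fin.lastCases ?_ (fun i => ?_) i <;> simp
  map_smul' c f := by
    ext i j
    refine Fin.lastCases ?_ (fun i => ?_) i <;> simp

theorem shift_zero {I : Ideal A} {a : A} (ha : a ∈ I) (J n : ℕ) (f : RefinedSum I J n)
    (j : Fin J) : shift ha J n f 0 j = 0 := rfl

theorem shift_succ {I : Ideal A} {a : A} (ha : a ∈ I) (J n : ℕ) (f : RefinedSum I J n)
    (i : Fin (n + 1)) (j : Fin J) :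
    shift ha J n f i.succ j = RefinedPiece.mul ha i j (f i j) := rfl

theorem incl_castSucc (I : Ideal A) (J n : ℕ) (f : RefinedSum I J n) (i : Fin (n + 1)) :
    incl I J n f i.castSucc = f i := by
  simp [incl]

theorem incl_last (I : Ideal A) (J n : ℕ) (f : RefinedSum I J n) :
    incl I J n f (Fin.last _) = 0 := by
  simp [incl]

theorem top_castSucc (I : Ideal A) (J n : ℕ) (g : (j : Fin J) → RefinedPiece I n j)
    (i : Fin n) : top I J n g i.castSucc = 0 := by
  simp [top]

theorem top_last (I : Ideal A) (J n : ℕ) (g : (j : Fin J) → RefinedPiece I n j) :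
    top I J n g (Fin.last _) = g := by
  simp [top]

theorem shift_shift {I : Ideal A} {a b : A} (ha : a ∈ I) (hb : b ∈ I) (J n : ℕ)
    (f : RefinedSum I J n) :
    shift ha J (n + 1) (shift hb J n f) = shift hb J (n + 1) (shift ha J n f) := by
  ext i j
  refine Fin.cases rfl (fun i => ?_) i
  rw [shift_succ, shift_succ]
  refine Fin.cases ?_ (fun i => ?_) i
  · simp only [shift_zero, map_zero]
  · rw [shift_succ, shift_succ]
    exact RefinedPiece.mul_comm' _ _ _ _ _

theorem shift_incl {I : Ideal A} {a : A} (ha : a ∈ I) (J n : ℕ) (f : RefinedSum I J n) :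
    shift ha J (n + 1) (incl I J n f) = incl I J (n + 1) (shift ha J n f) := by
  ext i j
  refine Fin.cases ?_ (fun i => ?_) i
  · rw [shift_zero]
    exact (congrFun (incl_castSucc I J (n + 1) (shift ha J n f) 0) j).symm
  rw [shift_succ]
  refine Fin.lastCases ?_ (fun i => ?_) i
  · rw [incl_last]
    have := congrFun (incl_last I J (n + 1) (shift ha J n f)) j
    exact (map_zero _).trans this.symm
  · rw [incl_castSucc]
    exact (congrFun (incl_castSucc I J (n + 1) (shift ha J n f) i.succ) j).symm

theorem shift_top {I : Ideal A} {a : A} (ha : a ∈ I) (J n : ℕ)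
    (g : (j : Fin J) → RefinedPiece I n j) :
    shift ha J n (top I J n g) = top I J (n + 1) fun j => RefinedPiece.mul ha n j (g j) := by
  ext i j
  refine Fin.lastCases ?_ (fun i => ?_) i
  · rw [top_last]
    show RefinedPiece.mul ha n j (top I J n g (Fin.last n) j) = _
    rw [top_last]
  · rw [top_castSucc]
    refine Fin.cases rfl (fun i => ?_) i
    show RefinedPiece.mul ha i j (top I J n g i.castSucc j) = 0
    rw [top_castSucc]
    exact map_zero _

theorem incl_add_top (I : Ideal A) (J n : ℕ) (f : RefinedSum I J (n + 1)) :
    f = incl I J n (fun i => f i.castSucc) + top I J (n + 1) (f (Fin.last _)) := by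
  ext i j
  refine Fin.lastCases ?_ (fun i => ?_) i
  · rw [Pi.add_apply, incl_last, top_last, zero_add]
  · rw [Pi.add_apply, incl_castSucc, top_castSucc, add_zero]

/-- The operators on the sums of graded pieces attached to generators of `I`. -/
noncomputable def op {I : Ideal A} {d : ℕ} {a : Fin d → A} (ha : ∀ s, a s ∈ I) (J : ℕ)
    (s : Fin (d + 1)) (n : ℕ) : RefinedSum I J n →ₗ[ResidueField A] RefinedSum I J (n + 1) :=
  -- Index `0` is the homogenizing variable, which passes from the graded pieces to their partial
  -- sums.
  Fin.cases (incl I J n) (fun s => shift (ha s) J n) s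

theorem op_comm {I : Ideal A} {d : ℕ} {a : Fin d → A} (ha : ∀ s, a s ∈ I) (J : ℕ)
    (s t : Fin (d + 1)) (n : ℕ) (f : RefinedSum I J n) :
    op ha J s (n + 1) (op ha J t n f) = op ha J t (n + 1) (op ha J s n f) := by
  refine Fin.cases ?_ (fun s => ?_) s <;> refine Fin.cases ?_ (fun t => ?_) t
  · rfl
  · exact (shift_incl _ _ _ _).symm
  · exact shift_incl _ _ _ _
  · exact shift_shift _ _ _ _ _

theorem iSup_range_op {I : Ideal A} {d : ℕ} {a : Fin d → A} (ha : Ideal.span (Set.range a) = I)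
    (has : ∀ s, a s ∈ I) (J n : ℕ) : ⨆ s, LinearMap.range (op has J s n) = ⊤ := by
  rw [eq_top_iff]
  rintro f -
  rw [incl_add_top I J n f]
  -- Everything below top degree comes from the extra variable; the top degree comes from the
  -- generators of `I`, one piece at a time.
  refine Submodule.add_mem _ (Submodule.mem_iSup_of_mem 0 ⟨_, rfl⟩) ?_
  generalize f (Fin.last (n + 1)) = g
  change (j : Fin J) → RefinedPiece I (n + 1) j at g
  rw [← Finset.univ_sum_single g, map_sum]
  refine Submodule.sum_mem _ fun j _ => ?_
  have hg : g j ∈ ⨆ s, LinearMap.range (RefinedPiece.mul (has s) n j) := by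
    rw [RefinedPiece.iSup_range_mul a ha]
    trivial
  have h : (⨆ s, LinearMap.range (RefinedPiece.mul (has s) n j)).map
      (top I J (n + 1) ∘ₗ LinearMap.single (ResidueField A) _ j) ≤
      ⨆ s, LinearMap.range (op has J s n) := by
    rw [Submodule.map_iSup]
    refine iSup_le fun s => le_trans ?_ (le_iSup _ s.succ)
    rintro _ ⟨_, ⟨p, rfl⟩, rfl⟩
    refine ⟨top I J n (Pi.single j p), ?_⟩
    show shift (has s) J n _ = _
    rw [shift_top]
    simp only [LinearMap.comp_apply, LinearMap.single_apply]
    congr 1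
    ext j'
    by_cases hj : j' = j
    · subst hj; simp
    · simp [Pi.single_eq_of_ne hj]
  exact h ⟨g j, hg, rfl⟩

end RefinedSum

/-- The graded system attached to an ideal with given generators. -/
noncomputable def refinedSystem [IsNoetherianRing A] {I : Ideal A} {d : ℕ} {a : Fin d → A}
    (ha : Ideal.span (Set.range a) = I) (J : ℕ) :
    GradedSystem (ResidueField A) (Fin (d + 1) → ResidueField A) :=
  GradedSystem.ofOperators (RefinedSum I J)
    (RefinedSum.op (fun s => ha ▸ Ideal.subset_span (Set.mem_range_self s)) J)
    (RefinedSum.op_comm _ _) (RefinedSum.iSup_range_op ha _ J)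

theorem length_eq_finrank_refinedSystem [IsNoetherianRing A] {I : Ideal A} {d : ℕ} {a : Fin d → A}
    (ha : Ideal.span (Set.range a) = I) {J : ℕ} (hJ : maximalIdeal A ^ J ≤ I) (n : ℕ) :
    Module.length A (A ⧸ I ^ (n + 1)) =
      (Module.finrank (ResidueField A) ((refinedSystem ha J).M n) : ℕ∞) := by
  rw [length_quotient_pow_succ hJ]
  have : Module.finrank (ResidueField A) ((refinedSystem ha J).M n) =
      ∑ i : Fin (n + 1), ∑ j : Fin J, Module.finrank (ResidueField A) (RefinedPiece I i j) := by
    show Module.finrank (ResidueField A) (RefinedSum I J n) = _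
    rw [Module.finrank_pi_fintype]
    refine Finset.sum_congr rfl fun i _ => ?_
    rw [Module.finrank_pi_fintype]
  rw [this]
  push_cast
  simp only [RefinedPiece.length_eq]

/-- The Hilbert-Samuel function of an ideal containing a power of the maximal ideal. -/
theorem exists_hilbertSamuel_function [IsNoetherianRing A] [Infinite (ResidueField A)]
    {I : Ideal A} {J : ℕ} (hJ : maximalIdeal A ^ J ≤ I) :
    ∃ h : ℕ → ℕ, (∀ n, Module.length A (A ⧸ I ^ (n + 1)) = (h n : ℕ∞)) ∧
      ∀ n, h (n + 1) ≤ h n + macaulayLower (n + 1) (h (n + 1)) := by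
  obtain ⟨d, a, ha⟩ := Submodule.fg_iff_exists_fin_generating_family.1
    (IsNoetherian.noetherian I)
  exact ⟨_, length_eq_finrank_refinedSystem ha hJ, (refinedSystem ha J).finrank_succ_le⟩

theorem exists_length_le_choose [IsNoetherianRing A] {I : Ideal A} {J d : ℕ} {a : Fin d → A}
    (ha : Ideal.span (Set.range a) = I) (hJ : maximalIdeal A ^ J ≤ I) :
    ∃ C : ℕ, ∀ n, Module.length A (A ⧸ I ^ (n + 1)) ≤ ((C * (n + d).choose d : ℕ) : ℕ∞) := by
  refine ⟨Module.finrank (ResidueField A) ((refinedSystem ha J).M 0), fun n => ?_⟩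
  rw [length_eq_finrank_refinedSystem ha hJ, Nat.cast_le]
  refine (refinedSystem ha J).finrank_le_choose d (fun s => Pi.single s 1) (fun n => ?_) n
  exact (iSup_congr fun s => congrArg _ (GradedSystem.ofOperators_act_single _ _ _ _ n s)).trans
    (RefinedSum.iSup_range_op ha (fun s => ha ▸ Ideal.subset_span (Set.mem_range_self s)) J n)

end LocalRing

/-! ### Bounding the list entries by the dimension. -/

theorem lexHilbert.le_of_eventually_le {l : List ℕ} (hl : l.Pairwise (· ≥ ·)) {C d : ℕ}
    (h : ∀ᶠ n in atTop, lexHilbert l n ≤ C * (n + d).choose d) : ∀ c ∈ l, c ≤ d := by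
  cases l with
  | nil => simp
  | cons b l =>
    rw [List.pairwise_cons] at hl
    suffices hb : b ≤ d by
      intro c hc
      rcases List.mem_cons.1 hc with rfl | hc
      · exact hb
      · exact le_trans (hl.1 c hc) hb
    by_contra! hb
    obtain ⟨n, hn, hle⟩ := ((eventually_ge_atTop (C * (d + 1))).and h).exists
    have h1 : (n + d + 1).choose (d + 1) ≤ lexHilbert (b :: l) n := by
      rw [lexHilbert]
      refine le_trans ?_ (Nat.le_add_right _ _)
      calc (n + d + 1).choose (d + 1) = (d + 1 + n).choose n := by
            rw [show n + d + 1 = (d + 1) + n by ring, Nat.choose_symm_add]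
        _ ≤ (b + n).choose n := Nat.choose_le_choose _ (by omega)
    have h2 := Nat.add_one_mul_choose_eq (n + d) d
    have h3 : 0 < (n + d).choose d := Nat.choose_pos (by omega)
    have h4 : (n + d + 1) * (n + d).choose d ≤ C * (d + 1) * (n + d).choose d := by
      rw [h2, mul_right_comm]
      exact Nat.mul_le_mul_right _ (h1.trans hle)
    have := Nat.le_of_mul_le_mul_right h4 h3
    omega

section LocalRing

variable {A : Type u} [CommRing A] [IsLocalRing A] [IsNoetherianRing A]

open IsLocalRing

/-- In a `d`-dimensional Noetherian local ring, an ideal containing a power of the maximal ideal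
contains such an ideal generated by `d` elements. -/
theorem exists_parameter_ideal_le {d : ℕ} (hdim : ringKrullDim A = (d : WithBot ℕ∞)) {I : Ideal A}
    {t : ℕ} (hI : maximalIdeal A ^ t ≤ I) :
    ∃ (a : Fin d → A) (J : ℕ), Ideal.span (Set.range a) ≤ I ∧
      maximalIdeal A ^ J ≤ Ideal.span (Set.range a) := by
  obtain ⟨s, hs, hcard⟩ :=
    Ideal.exists_finset_card_eq_height_of_isNoetherianRing (maximalIdeal A)
  have hsd : s.card = d := by
    have := maximalIdeal_height_eq_ringKrullDim (R := A)
    rw [hdim, ← hcard] at this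
    exact_mod_cast this
  have hsm : ∀ x ∈ s, x ∈ maximalIdeal A := fun x hx => hs.1.2 (Ideal.subset_span hx)
  let e := s.equivFinOfCardEq hsd
  have hrad : maximalIdeal A ≤
      (Ideal.span (Set.range fun i => (e.symm i : A) ^ (t + 1))).radical := by
    have h1 : Ideal.span (s : Set A) ≤
        (Ideal.span (Set.range fun i => (e.symm i : A) ^ (t + 1))).radical := by
      rw [Ideal.span_le]
      intro x hx
      refine ⟨t + 1, Ideal.subset_span ⟨e ⟨x, hx⟩, ?_⟩⟩
      simp
    refine le_trans ?_ (Ideal.radical_le_radical_iff.2 h1)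
    rw [Ideal.radical_eq_sInf]
    refine le_sInf fun p hp => ?_
    -- A prime containing the powers contains `s`, over which `𝔪` is minimal, so it is `𝔪`.
    exact hs.2 ⟨hp.2, hp.1⟩ (le_maximalIdeal hp.2.ne_top)
  obtain ⟨J, hJ⟩ := Ideal.exists_pow_le_of_le_radical_of_fg hrad (IsNoetherian.noetherian _)
  refine ⟨_, J, ?_, hJ⟩
  rw [Ideal.span_le]
  rintro _ ⟨i, rfl⟩
  exact hI (Ideal.pow_le_pow_right t.le_succ (Ideal.pow_mem_pow (hsm _ (e.symm i).2) _))

/-- The Hilbert-Samuel function agrees for large arguments with that of a lexicographic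
quotient of a polynomial ring. -/
theorem exists_eventually_length_eq_lexHilbert [Infinite (ResidueField A)] {d : ℕ}
    (hdim : ringKrullDim A = (d : WithBot ℕ∞)) {I : Ideal A} {t : ℕ}
    (hI : maximalIdeal A ^ t ≤ I) :
    ∃ l : List ℕ, l.Pairwise (· ≥ ·) ∧ (∀ c ∈ l, c ≤ d) ∧
      ∀ᶠ n in atTop, Module.length A (A ⧸ I ^ (n + 1)) = (lexHilbert l n : ℕ∞) := by
  obtain ⟨h, hlen, hh⟩ := exists_hilbertSamuel_function hI
  obtain ⟨l, hl, hlh⟩ := lexHilbert.exists_eventually_eq hh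
  obtain ⟨a, J, haI, hJ⟩ := exists_parameter_ideal_le hdim hI
  obtain ⟨C, hC⟩ := exists_length_le_choose (a := a) rfl hJ
  refine ⟨l, hl, lexHilbert.le_of_eventually_le (C := C) hl ?_, ?_⟩
  · filter_upwards [hlh] with n hn
    -- `A / I^(n+1)` is a quotient of `A / q^(n+1)` for the parameter ideal `q`, whose `d`
    -- generators give growth of order `n^d`.
    have hle := Ideal.pow_right_mono haI (n + 1)
    have := (Module.length_le_of_surjective (Submodule.factor hle)
      (Submodule.factor_surjective hle)).trans (hC n)
    rw [hlen, hn] at this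
    exact_mod_cast this
  · filter_upwards [hlh] with n hn
    rw [hlen, hn]

end LocalRing

/-! ### Hilbert coefficients of lexicographic functions. -/

/-- The coefficient of `binom(n + d - i, d - i)` in `binom(n - j + d - m, d - m)`. -/
def shiftCoeff (j m i : ℕ) : ℤ := if m ≤ i then (-1) ^ (i - m) * (j.choose (i - m) : ℤ) else 0

theorem shiftCoeff_succ (j m i : ℕ) :
    shiftCoeff (j + 1) m i = shiftCoeff j m i - shiftCoeff j (m + 1) i := by
  unfold shiftCoeff
  rcases lt_trichotomy m i with h | rfl | h
  · obtain ⟨k, rfl⟩ : ∃ k, i = m + 1 + k := ⟨i - (m + 1), by omega⟩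
    rw [if_pos (by omega), if_pos (by omega), if_pos (by omega),
      show m + 1 + k - m = k + 1 by omega, show m + 1 + k - (m + 1) = k by omega,
      Nat.choose_succ_succ']
    push_cast
    ring
  · simp
  · rw [if_neg (by omega), if_neg (by omega), if_neg (by omega), sub_zero]

/-- By Pascal's rule, lowering `n` by one acts on these binomials as `1 - T`, where `T` raises `m`;
the coefficients are those of `(1 - T)^j`. For `m = d` the binomial is constant and `T` kills it. -/
theorem choose_eq_sum_shiftCoeff (d : ℕ) : ∀ j m n : ℕ, m ≤ d → j ≤ n →
    ((n - j + (d - m)).choose (d - m) : ℤ) =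
      ∑ i ∈ Finset.range (d + 1), shiftCoeff j m i * ((n + (d - i)).choose (d - i) : ℤ) := by
  intro j
  induction j with
  | zero =>
    intro m n hm _
    rw [Finset.sum_eq_single_of_mem m (by simp; omega)]
    · simp [shiftCoeff]
    · intro i _ hi
      rw [shiftCoeff]
      split_ifs with h
      · rw [Nat.choose_eq_zero_of_lt (by omega)]; simp
      · simp
  | succ j ih =>
    intro m n hm hj
    simp only [shiftCoeff_succ, sub_mul, Finset.sum_sub_distrib]
    rw [← ih m n hm (by omega)]
    rcases hm.lt_or_eq with hm | rfl
    · rw [← ih (m + 1) n hm (by omega), show d - m = (d - (m + 1)) + 1 by omega,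
        show n - j + (d - (m + 1) + 1) = (n - (j + 1) + (d - (m + 1) + 1)) + 1 by omega,
        show n - j + (d - (m + 1)) = n - (j + 1) + (d - (m + 1) + 1) by omega,
        Nat.choose_succ_succ']
      push_cast
      ring
    · rw [Finset.sum_eq_zero]
      · simp
      · intro i hi
        rw [shiftCoeff, if_neg (by simp at hi; omega), zero_mul]

theorem lexHilbert_eq_sum : ∀ (l : List ℕ) (n : ℕ), lexHilbert l n =
    ∑ j ∈ Finset.range l.length, (l.getD j 0 + (n - j)).choose (n - j)
  | [], n => by simp [lexHilbert]
  | a :: l, n => by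
    rw [lexHilbert, lexHilbert_eq_sum l, List.length_cons, Finset.sum_range_succ', add_comm]
    congr 1
    refine Finset.sum_congr rfl fun j _ => ?_
    rw [List.getD_cons_succ, Nat.sub_sub, add_comm 1 j]

/-- The signed Hilbert coefficients `(-1)ⁱ eᵢ` of a lexicographic quotient. -/
def lexCoeff (l : List ℕ) (d i : ℕ) : ℤ :=
  ∑ j ∈ Finset.range l.length, shiftCoeff j (d - l.getD j 0) i

theorem lexHilbert_eq_sum_lexCoeff {l : List ℕ} {d n : ℕ} (hd : ∀ c ∈ l, c ≤ d)
    (hn : l.length ≤ n) : (lexHilbert l n : ℤ) =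
      ∑ i ∈ Finset.range (d + 1), lexCoeff l d i * ((n + (d - i)).choose (d - i) : ℤ) := by
  rw [lexHilbert_eq_sum]
  simp only [lexCoeff, Finset.sum_mul]
  rw [Finset.sum_comm]
  push_cast
  refine Finset.sum_congr rfl fun j hj => ?_
  rw [Finset.mem_range] at hj
  have hc : l.getD j 0 ≤ d := by
    rw [List.getD_eq_getElem _ _ hj]
    exact hd _ (List.getElem_mem hj)
  rw [← choose_eq_sum_shiftCoeff d j _ n (by omega) (by omega), Nat.sub_sub_self hc,
    add_comm (n - j), Nat.choose_symm_add]

/-- The number of entries of `l` that are at least `d - i`. -/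
def lexCount (l : List ℕ) (d i : ℕ) : ℕ :=
  ((Finset.range l.length).filter fun j => d - l.getD j 0 ≤ i).card

theorem filter_eq_range_lexCount {l : List ℕ} (hl : l.Pairwise (· ≥ ·)) (d i : ℕ) :
    ((Finset.range l.length).filter fun j => d - l.getD j 0 ≤ i) =
      Finset.range (lexCount l d i) := by
  refine Finset.eq_of_subset_of_card_le (fun x hx => ?_) (by rw [Finset.card_range]; rfl)
  rw [Finset.mem_range, lexCount, ← Nat.succ_le_iff]
  refine le_of_eq_of_le (Finset.card_range _).symm (Finset.card_le_card fun y hy => ?_)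
  simp only [Finset.mem_filter, Finset.mem_range, Nat.lt_succ_iff] at hx hy ⊢
  refine ⟨by omega, le_trans ?_ hx.2⟩
  rcases hy.lt_or_eq with hy | rfl
  · have := List.pairwise_iff_getElem.1 hl y x (by omega) hx.1 hy
    rw [List.getD_eq_getElem _ _ (show y < l.length by omega), List.getD_eq_getElem _ _ hx.1]
    omega
  · exact le_rfl

theorem lexCount_mono (l : List ℕ) (d : ℕ) : Monotone (lexCount l d) := fun i k hik =>
  Finset.card_le_card fun x hx => by
    simp only [Finset.mem_filter] at hx ⊢
    exact ⟨hx.1, hx.2.trans hik⟩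

theorem lexCoeff_zero (l : List ℕ) (d : ℕ) : lexCoeff l d 0 = lexCount l d 0 := by
  rw [lexCoeff, lexCount, Finset.card_filter]
  push_cast
  refine Finset.sum_congr rfl fun j _ => ?_
  rw [shiftCoeff]
  split_ifs <;> simp

/-- The error term in the comparison of `lexCoeff` and `lexCount`. -/
def lexError (b : ℕ → ℕ) (i : ℕ) : ℕ :=
  b i + (b i).choose 2 + ∑ k ∈ Finset.Icc 3 (i + 1), (b (i + 1 - k)).choose (k + 1)

theorem sum_range_choose_eq (b k : ℕ) : ∑ j ∈ Finset.range b, j.choose k = b.choose (k + 1) := by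
  induction b with
  | zero => simp
  | succ b ih => rw [Finset.sum_range_succ, ih, Nat.choose_succ_succ', add_comm]

/-- Compare entry by entry. With `k = i + 1 - m`, the `j`-th entry contributes `(-1)^k binom(j, k)`
to the coefficient. For `k = 0` this is the `1` being counted; for `k = 1` the term `-j` is offset
by `binom(bᵢ, 2)`; for `k = 2` it is nonnegative and needs no correction; for `k ≥ 3` the `k`-th
summand of the error offsets either sign. The term `bᵢ` supplies the `1` for all `k ≥ 1`. -/
theorem lexCount_le {l : List ℕ} (hl : l.Pairwise (· ≥ ·)) (d i : ℕ) :
    (lexCount l d (i + 1) : ℤ) ≤ lexCoeff l d (i + 1) + lexError (lexCount l d) i := by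
  have hsum : ∀ t k, ∑ j ∈ Finset.range l.length,
      (if d - l.getD j 0 ≤ t then (j.choose k : ℤ) else 0) =
      ((lexCount l d t).choose (k + 1) : ℤ) := by
    intro t k
    rw [← Finset.sum_filter, filter_eq_range_lexCount hl]
    exact_mod_cast sum_range_choose_eq _ _
  have hcount : ∀ t, (lexCount l d t : ℤ) = ∑ j ∈ Finset.range l.length,
      (if d - l.getD j 0 ≤ t then ((j.choose 0 : ℕ) : ℤ) else 0) := fun t => by
    rw [hsum]; simp
  rw [lexError]
  push_cast
  rw [hcount (i + 1), hcount i, ← hsum i 1]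
  simp only [← hsum]
  rw [Finset.sum_comm, lexCoeff, ← Finset.sum_add_distrib, ← Finset.sum_add_distrib,
    ← Finset.sum_add_distrib]
  refine Finset.sum_le_sum fun j _ => ?_
  set m := d - l.getD j 0
  have hnn : ∀ k, (0 : ℤ) ≤ if m ≤ i + 1 - k then (j.choose k : ℤ) else 0 := fun k => by
    split_ifs <;> simp
  have hnn' := Finset.sum_nonneg fun k (_ : k ∈ Finset.Icc 3 (i + 1)) => hnn k
  rw [shiftCoeff]
  by_cases h1 : m ≤ i + 1
  swap
  · simp only [if_neg h1, if_neg (show ¬ m ≤ i by omega)]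
    omega
  rw [if_pos h1, if_pos h1]
  by_cases h2 : m ≤ i
  swap
  · rw [show i + 1 - m = 0 by omega, if_neg h2, if_neg h2]
    simpa using hnn'
  rw [if_pos h2, if_pos h2]
  simp only [Nat.choose_zero_right, Nat.choose_one_right, Nat.cast_one]
  obtain ⟨k, hk⟩ : ∃ k, k = i + 1 - m := ⟨_, rfl⟩
  rw [← hk]
  rcases (by omega : k = 1 ∨ k = 2 ∨ 3 ≤ k) with rfl | rfl | hk3
  · simp; omega
  · simp; omega
  · have h3 := Finset.single_le_sum (fun k (_ : k ∈ Finset.Icc 3 (i + 1)) => hnn k)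
      (Finset.mem_Icc.2 ⟨hk3, by omega⟩ : k ∈ Finset.Icc 3 (i + 1))
    rw [if_pos (by omega)] at h3
    have h4 : -((j.choose k : ℕ) : ℤ) ≤ (-1) ^ k * (j.choose k : ℤ) := by
      rcases neg_one_pow_eq_or ℤ k with h | h <;> rw [h] <;> simp
    omega

/-! ### Doubly exponential estimates. -/

theorem sum_half_pow_Icc_le (i : ℕ) : ∑ k ∈ Finset.Icc 3 i, (1 / 2 : ℝ) ^ k ≤ 1 / 2 := by
  rcases lt_or_ge i 2 with hi | hi
  · rw [Finset.Icc_eq_empty (by omega)]; norm_num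
  suffices H : ∑ k ∈ Finset.Icc 3 i, (1 / 2 : ℝ) ^ k + (1 / 2) ^ i ≤ 1 / 2 by
    have : (0 : ℝ) ≤ (1 / 2) ^ i := by positivity
    linarith
  induction i, hi using Nat.le_induction with
  | base => norm_num
  | succ i hi ih =>
    rw [Finset.sum_Icc_succ_top (by omega), pow_succ]
    linarith

theorem two_pow_le_factorial_succ (k : ℕ) : 2 ^ k ≤ (k + 1).factorial := by
  induction k with
  | zero => simp
  | succ k ih =>
    rw [Nat.factorial_succ, pow_succ, mul_comm]
    exact Nat.mul_le_mul (by omega) ih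

theorem choose_succ_le_pow_mul (b k : ℕ) :
    ((b.choose (k + 1) : ℕ) : ℝ) ≤ (b : ℝ) ^ (k + 1) * (1 / 2) ^ k := by
  refine (Nat.choose_le_pow_div (α := ℝ) (k + 1) b).trans ?_
  rw [div_eq_mul_inv, one_div, inv_pow]
  gcongr
  exact_mod_cast two_pow_le_factorial_succ k

/-- With `Y = X^(2^i)`, the first two terms are `bᵢ(bᵢ + 1)/2 ≤ Y(Y - 1)/2`. Since `k + 1 ≤ 2^(k-1)`
for `k ≥ 3`, the `k`-th remaining term is at most `Y / 2^k`, and these sum to at most the missing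
`Y/2`. -/
theorem lexError_le {b : ℕ → ℕ} {i : ℕ} {X : ℝ} (hX : 1 ≤ X)
    (h : ∀ t ≤ i, (b t : ℝ) + 1 ≤ X ^ 2 ^ t) :
    (lexError b i : ℝ) ≤ 1 / 2 * X ^ 2 ^ (i + 1) := by
  set Y := X ^ 2 ^ i with hY
  have hY0 : 0 < Y := by positivity
  have hYY : X ^ 2 ^ (i + 1) = Y * Y := by rw [hY, ← pow_add, pow_succ, mul_two]
  have h1 : (b i : ℝ) + ((b i).choose 2 : ℕ) ≤ Y * (Y - 1) / 2 := by
    rw [Nat.cast_choose_two]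
    have := h i le_rfl
    have h0 : (0 : ℝ) ≤ b i := Nat.cast_nonneg _
    nlinarith
  have h2 : ∀ k ∈ Finset.Icc 3 (i + 1),
      (((b (i + 1 - k)).choose (k + 1) : ℕ) : ℝ) ≤ Y * (1 / 2) ^ k := by
    intro k hk
    rw [Finset.mem_Icc] at hk
    refine (choose_succ_le_pow_mul _ _).trans ?_
    gcongr
    have h3 : (b (i + 1 - k) : ℝ) ≤ X ^ 2 ^ (i + 1 - k) := by
      have := h (i + 1 - k) (by omega)
      linarith
    refine (pow_le_pow_left₀ (Nat.cast_nonneg _) h3 _).trans ?_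
    rw [← pow_mul]
    refine pow_le_pow_right₀ hX ?_
    have h5 : ∀ k, 3 ≤ k → k + 1 ≤ 2 ^ (k - 1) := by
      intro k hk
      induction k, hk using Nat.le_induction with
      | base => norm_num
      | succ k hk ih =>
        rw [show k + 1 - 1 = (k - 1) + 1 by omega, pow_succ]
        omega
    calc 2 ^ (i + 1 - k) * (k + 1) ≤ 2 ^ (i + 1 - k) * 2 ^ (k - 1) :=
          Nat.mul_le_mul_left _ (h5 k hk.1)
      _ = 2 ^ i := by rw [← pow_add]; congr 1; omega
  have h3 : ∑ k ∈ Finset.Icc 3 (i + 1), (((b (i + 1 - k)).choose (k + 1) : ℕ) : ℝ) ≤ Y * (1 / 2) := by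
    refine (Finset.sum_le_sum h2).trans ?_
    rw [← Finset.mul_sum]
    exact mul_le_mul_of_nonneg_left (sum_half_pow_Icc_le _) hY0.le
  rw [lexError, hYY]
  push_cast
  linarith

theorem add_one_le_pow_of_le_add_lexError {b : ℕ → ℕ} {ξ : ℕ → ℤ} (hξ : Monotone ξ)
    (h0 : (b 0 : ℤ) ≤ ξ 0) {d : ℕ} (hb : ∀ i < d, (b (i + 1) : ℤ) ≤ ξ (i + 1) + lexError b i) :
    ∀ i ≤ d, (b i : ℝ) + 1 ≤ ((ξ i : ℝ) + 1) ^ 2 ^ i := by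
  have hξ0 : ∀ i, 0 ≤ ξ i := fun i => le_trans (by positivity) (h0.trans (hξ (Nat.zero_le i)))
  intro i
  induction i using Nat.strong_induction_on with
  | _ i ih =>
  intro hi
  cases i with
  | zero =>
    have : (b 0 : ℝ) ≤ ξ 0 := by exact_mod_cast h0
    simpa using this
  | succ i =>
    have hX : (1 : ℝ) ≤ (ξ (i + 1) : ℝ) + 1 := by
      have : (0 : ℝ) ≤ ξ (i + 1) := by exact_mod_cast hξ0 _
      linarith
    have h1 := lexError_le hX fun t (ht : t ≤ i) => (ih t (by omega) (by omega)).trans (by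
      have h2 : (0 : ℝ) ≤ ξ t := by exact_mod_cast hξ0 _
      have h3 : (ξ t : ℝ) ≤ ξ (i + 1) := by exact_mod_cast hξ (by omega)
      gcongr)
    have h2 : (b (i + 1) : ℝ) ≤ ξ (i + 1) + lexError b i := by exact_mod_cast hb i (by omega)
    -- For `ξ ≥ 1`, `ξ + 1` is at most half its square, which absorbs the linear term. For `ξ = 0`
    -- the bound reads `b ≤ 1/2`, and integrality gives `b = 0`.
    rcases (hξ0 (i + 1)).lt_or_eq with h | h
    · have h3 : (2 : ℝ) ≤ (ξ (i + 1) : ℝ) + 1 := by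
        have : (1 : ℝ) ≤ ξ (i + 1) := by exact_mod_cast h
        linarith
      have h4 : ((ξ (i + 1) : ℝ) + 1) ^ 2 ≤ ((ξ (i + 1) : ℝ) + 1) ^ 2 ^ (i + 1) :=
        pow_le_pow_right₀ hX (by rw [pow_succ]; have := Nat.one_le_two_pow (n := i); omega)
      nlinarith
    · rw [← h] at h1 h2 ⊢
      simp only [Int.cast_zero, zero_add, one_pow, mul_one] at h1 h2 ⊢
      have h3 : (b (i + 1) : ℝ) < 1 := by linarith
      have h4 : b (i + 1) = 0 := by
        have : b (i + 1) < 1 := by exact_mod_cast h3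
        omega
      rw [h4]
      simp

/-! ### Conclusion for the Hilbert coefficients. -/

theorem hilbertXi_mono {A : Type*} [CommRing A] (I : Ideal A) (d : ℕ) :
    Monotone (hilbertXi I d) :=
  monotone_nat_of_le_succ fun _ => le_max_left _ _

theorem abs_hilbertCoeff_le_hilbertXi {A : Type*} [CommRing A] (I : Ideal A) (d i : ℕ) :
    |hilbertCoeff I d (i + 1)| ≤ hilbertXi I d (i + 1) :=
  le_max_right _ _

theorem IsHilbertCoeffs.hilbertCoeff_eq {A : Type*} [CommRing A] {I : Ideal A} {d : ℕ}
    {e : ℕ → ℤ} (he : IsHilbertCoeffs I d e) : hilbertCoeff I d = e := by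
  have h : ∃ e : ℕ → ℤ, IsHilbertCoeffs I d e := ⟨e, he⟩
  rw [hilbertCoeff, dif_pos h]
  exact h.choose_spec.unique he

theorem corollaryC {A : Type*} [CommRing A] [IsLocalRing A] [IsNoetherianRing A]
    [Infinite (IsLocalRing.ResidueField A)]
    (d : ℕ) (hd : 1 ≤ d) (hdim : ringKrullDim A = (d : WithBot ℕ∞))
    (I : Ideal A) (hI : IsMaximalPrimary I) (hchar : IsEquicharLocalRing (A ⧸ I)) :
    IsHilbertCoeffs I d (hilbertCoeff I d) ∧
    ∀ i : ℕ, 1 ≤ i → i ≤ d →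
      (-1 : ℝ) ^ (i - 1) * (hilbertCoeff I d i : ℝ) <
        7 / 12 * ((hilbertXi I d (i - 1) : ℝ) + 1) ^ (2 ^ i) - (hilbertCoeff I d 0 : ℝ) := by
  obtain ⟨t, ht⟩ := Ideal.exists_pow_le_of_le_radical_of_fg hI.2.ge (IsNoetherian.noetherian _)
  obtain ⟨l, hl, hld, hlen⟩ := exists_eventually_length_eq_lexHilbert hdim ht
  have he : IsHilbertCoeffs I d fun i => if i ≤ d then (-1) ^ i * lexCoeff l d i else 0 := by
    refine ⟨?_, fun i hi => if_neg (by omega)⟩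
    filter_upwards [hlen, eventually_ge_atTop l.length] with n hn hn'
    refine ⟨_, hn, ?_⟩
    rw [lexHilbert_eq_sum_lexCoeff hld hn']
    refine Finset.sum_congr rfl fun i hi => ?_
    rw [if_pos (by simpa [Nat.lt_succ_iff] using hi), ← mul_assoc, ← mul_pow]
    norm_num
  have hcoeff := he.hilbertCoeff_eq
  refine ⟨hcoeff ▸ he, fun i hi1 hid => ?_⟩
  obtain ⟨i, rfl⟩ : ∃ k, i = k + 1 := ⟨i - 1, by omega⟩
  have h0 : hilbertCoeff I d 0 = lexCount l d 0 := by
    rw [hcoeff]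
    simp [lexCoeff_zero]
  have hxi : ∀ k < d, lexCoeff l d (k + 1) ≤ hilbertXi I d (k + 1) := by
    intro k hk
    refine le_trans ?_ (abs_hilbertCoeff_le_hilbertXi I d k)
    rw [hcoeff]
    simp only [if_pos (show k + 1 ≤ d by omega), abs_mul, abs_pow, abs_neg, abs_one, one_pow,
      one_mul]
    exact le_abs_self _
  have hb := add_one_le_pow_of_le_add_lexError (hilbertXi_mono I d) (b := lexCount l d)
    (by rw [hilbertXi, h0]) (d := d) fun k hk =>
      (lexCount_le hl d k).trans (by have := hxi k hk; omega)
  have hnn : ∀ k, 0 ≤ hilbertXi I d k := fun k =>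
    le_trans (by rw [hilbertXi, h0]; positivity) (hilbertXi_mono I d (Nat.zero_le k))
  have hX : (1 : ℝ) ≤ (hilbertXi I d i : ℝ) + 1 := by
    have : (0 : ℝ) ≤ hilbertXi I d i := by exact_mod_cast hnn i
    linarith
  have herr := lexError_le hX fun t (ht : t ≤ i) => (hb t (by omega)).trans (by
    have h2 : (0 : ℝ) ≤ hilbertXi I d t := by exact_mod_cast hnn t
    have h3 : (hilbertXi I d t : ℝ) ≤ hilbertXi I d i := by exact_mod_cast hilbertXi_mono I d ht
    gcongr)
  have hle : (lexCount l d (i + 1) : ℝ) ≤ lexCoeff l d (i + 1) + lexError (lexCount l d) i := by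
    exact_mod_cast lexCount_le hl d i
  have hmono : (lexCount l d 0 : ℝ) ≤ lexCount l d (i + 1) := by
    exact_mod_cast lexCount_mono l d (Nat.zero_le _)
  have hei : (-1 : ℝ) ^ (i + 1 - 1) * (hilbertCoeff I d (i + 1) : ℝ) = -lexCoeff l d (i + 1) := by
    rw [hcoeff]
    simp only [if_pos hid, Nat.add_sub_cancel]
    push_cast
    rw [← mul_assoc, ← pow_add, show i + (i + 1) = 2 * i + 1 by ring, pow_succ, pow_mul]
    simp
  rw [hei, h0, Nat.add_sub_cancel]
  -- Strictness comes from `1/2 < 7/12` and the positivity of the power.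
  have hpos : (0 : ℝ) < ((hilbertXi I d i : ℝ) + 1) ^ 2 ^ (i + 1) := by positivity
  push_cast
  linarith
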